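/- **Definitions.** A stochastic block model $\mathbb{SBM}(p,Q)$ on $k\ge 1$ communities consists of a probability vector $p\in[0,1]^k$ and a symmetric matrix $Q\in[-1,1]^{k\times k}$. A sample from $\mathbb{SBM}(n;p,Q)$ is a graph on $n$ labelled vertices obtained by drawing labels $x_1,\dots,x_n$ i.i.d. from $p$ and then joining each pair $i<j$ independently with probability $(1+Q_{x_i,x_j})/2$. The parameters $k=k_n$, $p=p^{(n)}$, $Q=Q^{(n)}$ may depend on $n$ in an arbitrary way (in particular they may be constant in $n$). Statistics $f_n$ of graphs on $n$ vertices *distinguish* $\mathbb{G}(n,1/2)$ and $\mathbb{SBM}(n;p,Q)$ *with high probability* (in the sense of low-degree tests) if $$\Big|\mathbb{E}_{\mathbb{G}(n,1/2)}f_n-\mathbb{E}_{\mathbb{SBM}(n;p,Q)}f_n\Big|=\omega\Big(\sqrt{\mathrm{Var}_{\mathbb{G}(n,1/2)}f_n+\mathrm{Var}_{\mathbb{SBM}(n;p,Q)}f_n}\Big)\qquad(n\to\infty),$$ that is, for every $C>0$ the left-hand side is strictly larger than $C$ times the square root for all large $n$. A *constant-degree test* is a sequence $f_n$ of real polynomials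 in the $\binom n2$ edge indicators of degrees bounded by some $D$ that does not depend on $n$. The *signed count* of a graph $H$ in a graph $G$ on $n$ vertices is $\mathsf{SC}_H(G)=\sum_{A}\prod_{e\in E(A)}(2\cdot\mathbf 1[e\in E(G)]-1)$, the sum running over all subgraphs $A$ of the complete graph $K_n$ that are isomorphic to $H$. $\mathsf{Star}_t$ is the star with $t$ edges, so that $\mathsf{Star}_1$ is an edge and $\mathsf{Star}_2$ is a wedge. **Theorem (Testing in Diagonal SBMs).** Suppose that $Q^{(n)}$ is diagonal for every $n$ (all off-diagonal entries are $0$). If some constant-degree test distinguishes $\mathbb{G}(n,1/2)$ and $\mathbb{SBM}(n;p,Q)$ with high probability, then so does the signed $\mathsf{Star}_1$ (edge) count or the signed $\mathsf{Star}_2$ (wedge) count. Precisely, there are $t_n\in\{1,2\}$, with $t_m=t_n$ whenever the models with indices $m$ and $n$ have the same parameters $(k,p,Q)$ (so $t_n$ is constant if the model does not depend on $n$), such that the statistics $\mathsf{SC}_{\mathsf{Star}_{t_n}}$ distinguish $\mathbb{G}(n,1/2)$ and $\mathbb{SBM}(n;p,Q)$ with high probability. Moreover, for suitable thresholds $c_n\in\mathbb{R}$,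 the test that rejects $\mathbb{G}(n,1/2)$ when $|\mathsf{SC}_{\mathsf{Star}_{t_n}}|\ge c_n$ has both error probabilities tending to $0$: $$\Pr_{\mathbb{G}(n,1/2)}\big[|\mathsf{SC}_{\mathsf{Star}_{t_n}}|\ge c_n\big]\to0,\qquad \Pr_{\mathbb{SBM}(n;p,Q)}\big[|\mathsf{SC}_{\mathsf{Star}_{t_n}}|< c_n\big]\to 0 .$$ -/

import Mathlib

open MeasureTheory ProbabilityTheory Filter Topology

noncomputable section

/-- A stochastic block model on `k` communities: a probability vector `p` on the labels and a
symmetric matrix `Q` with entries in `[-1, 1]`. Vertices with labels `a` and `b` are adjacent with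
probability `(1 + Q a b) / 2`. -/
structure SBM where
  k : ℕ
  p : Fin k → ℝ
  Q : Matrix (Fin k) (Fin k) ℝ
  p_nonneg : ∀ a, 0 ≤ p a
  p_sum : ∑ a, p a = 1
  Q_symm : Q.IsSymm
  Q_le : ∀ a b, |Q a b| ≤ 1

/-- The probability that the random graph on `n` vertices with law `SBM(n; p, Q)` equals `G`: the
labels `x 0, …, x (n - 1)` are drawn independently from `p` and, given the labels, the pairs `i < j`
are joined independently with probability `(1 + Q (x i) (x j)) / 2`. -/
def SBM.mass (M : SBM) (n : ℕ) (G : SimpleGraph (Fin n)) : ℝ :=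
  open scoped Classical in
  ∑ x : Fin n → Fin M.k, (∏ i, M.p (x i)) *
    ∏ i, ∏ j ∈ Finset.Ioi i,
      if G.Adj i j then (1 + M.Q (x i) (x j)) / 2 else (1 - M.Q (x i) (x j)) / 2

/-- The law `SBM(n; p, Q)` on graphs with vertex set `Fin n`. -/
def SBM.law (M : SBM) (n : ℕ) : Measure (SimpleGraph (Fin n)) :=
  open scoped Classical in
  ∑ G : SimpleGraph (Fin n), ENNReal.ofReal (M.mass n G) • Measure.dirac G

/-- The null law `G(n, 1/2)`. -/
def nullLaw (n : ℕ) : Measure (SimpleGraph (Fin n)) :=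
  SimpleGraph.binomialRandom (Fin n) ⟨1 / 2, by norm_num, by norm_num⟩

/-- `f` is a polynomial of degree at most `D` in the edge indicators of a graph on `n` vertices. -/
def IsPolyDegreeLE (D : ℕ) {n : ℕ} (f : SimpleGraph (Fin n) → ℝ) : Prop :=
  open scoped Classical in
  ∃ P : MvPolynomial {e : Sym2 (Fin n) // ¬ e.IsDiag} ℝ, P.totalDegree ≤ D ∧
    ∀ G : SimpleGraph (Fin n), f G = MvPolynomial.eval
      (fun e : {e : Sym2 (Fin n) // ¬ e.IsDiag} => if e.1 ∈ G.edgeSet then (1 : ℝ) else 0) P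

/-- The sequence of statistics `f n` distinguishes `G(n, 1/2)` from the model `M n` with high
probability, in the sense of low-degree tests: the gap between the two means is
`ω(√(Var_null + Var_SBM))`. -/
def Distinguishes (M : ℕ → SBM) (f : (n : ℕ) → SimpleGraph (Fin n) → ℝ) : Prop :=
  ∀ C : ℝ, 0 < C → ∀ᶠ n in atTop,
    C * √(Var[f n; nullLaw n] + Var[f n; (M n).law n]) <
      |(∫ G, f n G ∂(nullLaw n)) - ∫ G, f n G ∂((M n).law n)|

/-- The signed count of `H` in `G`: the sum over all subgraphs `A` of the complete graph on the
vertices of `G` that are isomorphic to `H` of `∏ (2 * 1[e ∈ G] - 1)` over the edges `e` of `A`. -/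
def signedCount {V : Type*} (H : SimpleGraph V) {n : ℕ} (G : SimpleGraph (Fin n)) : ℝ :=
  open scoped Classical in
  ∑ A : (⊤ : SimpleGraph (Fin n)).Subgraph with Nonempty (H ≃g A.coe),
    ∏ e : Sym2 (Fin n) with e ∈ A.edgeSet, (2 * (if e ∈ G.edgeSet then (1 : ℝ) else 0) - 1)

/-- The star with `t` edges: `t = 1` is a single edge and `t = 2` is a wedge. -/
def starWithEdges (t : ℕ) : SimpleGraph (Fin (t + 1)) := SimpleGraph.starGraph 0

end

/-! Under `G(n, 1/2)` the characters of sets of pairs are orthonormal, and a polynomial of degree at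
most `D` is a combination of characters of at most `D` pairs. By Cauchy-Schwarz the squared gap of
the means is at most the null variance times the sum of `φ(S)²` over nonempty `S` with at most `D`
pairs, where `φ(S)` is the mean of the character in the block model (`sq_expect_sub_le`).

If `Q` is diagonal, a bichromatic pair has conditional mean `0`, so only labellings constant on the
components of `S` contribute. Hence `φ(S)` is the product over components, with `v` vertices and `j`
edges, of `m(v, j) = ∑ p_a ^ v q_a ^ j` (`phi_eq_prod_components`). Put `e = |m(2, 1)|` and `w =
m(3, 2)`. If `e ≤ r²` and `w ≤ r³`, then `p_a |q_a| ≤ r`, and each vertex touched by `S` costs a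
factor `r` in `|φ(S)|`. Since `O(n ^ u)` sets `S` touch `u` vertices, the sum is bounded as soon as
`r² = O(1/n)`. A successful test therefore forces `n e` or `n^(3/2) w` above any given bound
(`Distinguishes.eventually_moment_large`).

Conversely, the edge count has mean of order `n² m(2, 1)` and variance `O(n² + n³ w)`, so it
succeeds when `w ≤ e` and `n e → ∞`. The wedge count has mean of order `n³ w` and variance `O(n³ +
n⁴ w + n⁵ m(5, 4))` with `m(5, 4) ≤ w^(3/2)`, so it succeeds when `n^(3/2) w → ∞`. The edge is
chosen when `√n w ≤ e`, which turns either alternative into the strength of the chosen count. As the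
choice may depend on the model only, `n` is replaced there by the first index at which the model
occurs (`eventually_lt_signal`). Chebyshev's inequality gives the thresholds. -/

/-! ### Fourier characters on graphs. -/

/-- The non-loop pairs of vertices. -/
def pairSet (n : ℕ) : Finset (Sym2 (Fin n)) := Finset.univ.filter fun e => ¬ e.IsDiag

lemma mem_pairSet {n : ℕ} {e : Sym2 (Fin n)} : e ∈ pairSet n ↔ ¬ e.IsDiag := by
  simp [pairSet]

lemma prod_pairs {n : ℕ} (h : Sym2 (Fin n) → ℝ) :
    ∏ i, ∏ j ∈ Finset.Ioi i, h s(i, j) = ∏ e ∈ pairSet n, h e := by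
  rw [Finset.prod_sigma']
  refine Finset.prod_bij (fun a _ => s(a.1, a.2)) ?_ ?_ ?_ ?_
  · rintro ⟨i, j⟩ h
    simp only [Finset.mem_sigma, Finset.mem_univ, Finset.mem_Ioi, true_and] at h
    simp [mem_pairSet, h.ne]
  · rintro ⟨i, j⟩ h ⟨i', j'⟩ h' heq
    simp only [Finset.mem_sigma, Finset.mem_univ, Finset.mem_Ioi, true_and] at h h'
    simp only [Sym2.eq_iff] at heq
    rcases heq with ⟨rfl, rfl⟩ | ⟨rfl, rfl⟩
    · rfl
    · exact absurd h h'.asymm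
  · intro e
    induction e with | _ i j
    intro he
    have hne : i ≠ j := by simpa [mem_pairSet] using he
    rcases lt_or_gt_of_ne hne with h | h
    · exact ⟨⟨i, j⟩, by simpa using h, rfl⟩
    · exact ⟨⟨j, i⟩, by simpa using h, Sym2.eq_swap⟩
  · intros; rfl

open scoped Classical in
/-- Summing over graphs a product over pairs of vertices. -/
lemma sum_graph_prod {n : ℕ} (f g : Sym2 (Fin n) → ℝ) :
    ∑ G : SimpleGraph (Fin n), ∏ e ∈ pairSet n, (if e ∈ G.edgeSet then f e else g e) =
      ∏ e ∈ pairSet n, (f e + g e) := by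
  rw [Finset.prod_add]
  refine Finset.sum_bij' (fun G _ => (pairSet n).filter (· ∈ G.edgeSet))
    (fun t _ => SimpleGraph.fromEdgeSet t) ?_ ?_ ?_ ?_ ?_
  · intro G _
    exact Finset.mem_powerset.2 (Finset.filter_subset _ _)
  · simp
  · intro G _
    ext i j
    simp only [Finset.coe_filter, SimpleGraph.fromEdgeSet_adj, Set.mem_ofPred_eq, mem_pairSet,
      SimpleGraph.mem_edgeSet]
    exact ⟨fun h => h.1.2, fun h => ⟨⟨by simpa using h.ne, h⟩, h.ne⟩⟩
  · intro t ht
    rw [Finset.mem_powerset] at ht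
    ext e
    simp only [Finset.mem_filter, SimpleGraph.edgeSet_fromEdgeSet, Set.mem_sdiff,
      Finset.mem_coe]
    constructor
    · exact fun h => h.2.1
    · exact fun h => ⟨ht h, h, fun hd => (mem_pairSet.1 (ht h)) hd⟩
  · intro G _
    rw [Finset.prod_ite]
    congr 1
    refine Finset.prod_congr ?_ fun _ _ => rfl
    ext e; simp only [Finset.mem_filter, Finset.mem_sdiff]; tauto

open scoped Classical in
/-- The signed indicator of the pair `e`. -/
noncomputable def spin {n : ℕ} (G : SimpleGraph (Fin n)) (e : Sym2 (Fin n)) : ℝ :=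
  2 * (if e ∈ G.edgeSet then (1 : ℝ) else 0) - 1

/-- The Fourier character of a set of pairs. -/
noncomputable def character {n : ℕ} (S : Finset (Sym2 (Fin n))) (G : SimpleGraph (Fin n)) : ℝ :=
  ∏ e ∈ S, spin G e

lemma spin_mul_self {n : ℕ} (G : SimpleGraph (Fin n)) (e : Sym2 (Fin n)) :
    spin G e * spin G e = 1 := by
  unfold spin; split_ifs <;> norm_num

-- Spins square to `1`, so the pairs common to both sets cancel.
open scoped Classical in
lemma character_mul {n : ℕ} (S T : Finset (Sym2 (Fin n))) (G : SimpleGraph (Fin n)) :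
    character S G * character T G = character (symmDiff S T) G := by
  have h1 : character S G = character (S \ T) G * character (S ∩ T) G := by
    unfold character
    rw [← Finset.prod_union (Finset.disjoint_sdiff_inter S T), Finset.sdiff_union_inter]
  have h2 : character T G = character (T \ S) G * character (S ∩ T) G := by
    unfold character
    rw [Finset.inter_comm, ← Finset.prod_union (Finset.disjoint_sdiff_inter T S),
      Finset.sdiff_union_inter]
  have h3 : character (S ∩ T) G * character (S ∩ T) G = 1 := by
    unfold character
    rw [← Finset.prod_mul_distrib]
    exact Finset.prod_eq_one fun e _ => spin_mul_self G e
  have h4 : character (symmDiff S T) G = character (S \ T) G * character (T \ S) G := by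
    unfold character
    rw [← Finset.prod_union disjoint_sdiff_sdiff]; rfl
  rw [h1, h2, h4]
  linear_combination (character (S \ T) G * character (T \ S) G) * h3

/-! ### Means over labels and means of characters in a block model. -/

namespace SBM

/-- The conditional mean of the signed indicator of a pair, given the labels `x`. -/
noncomputable def edgeWeight (M : SBM) {n : ℕ} (x : Fin n → Fin M.k) : Sym2 (Fin n) → ℝ :=
  Sym2.lift ⟨fun i j => M.Q (x i) (x j), fun _ _ => M.Q_symm.apply _ _⟩

@[simp] lemma edgeWeight_mk (M : SBM) {n : ℕ} (x : Fin n → Fin M.k) (i j : Fin n) :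
    M.edgeWeight x s(i, j) = M.Q (x i) (x j) := rfl

lemma abs_edgeWeight_le (M : SBM) {n : ℕ} (x : Fin n → Fin M.k) (e : Sym2 (Fin n)) :
    |M.edgeWeight x e| ≤ 1 := by
  induction e with | _ i j
  exact M.Q_le _ _

/-- The mean of a function of the labels. -/
noncomputable def labelMean (M : SBM) {n : ℕ} (F : (Fin n → Fin M.k) → ℝ) : ℝ :=
  ∑ x, (∏ i, M.p (x i)) * F x

lemma labelWeight_nonneg (M : SBM) {n : ℕ} (x : Fin n → Fin M.k) : 0 ≤ ∏ i, M.p (x i) :=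
  Finset.prod_nonneg fun _ _ => M.p_nonneg _

lemma labelMean_mono (M : SBM) {n : ℕ} {F F' : (Fin n → Fin M.k) → ℝ} (h : ∀ x, F x ≤ F' x) :
    M.labelMean F ≤ M.labelMean F' :=
  Finset.sum_le_sum fun x _ => mul_le_mul_of_nonneg_left (h x) (M.labelWeight_nonneg x)

/-- The mean of a product of functions of single labels. -/
lemma labelMean_prod (M : SBM) {n : ℕ} (h : Fin n → Fin M.k → ℝ) :
    M.labelMean (fun x => ∏ i, h i (x i)) = ∏ i, ∑ a, M.p a * h i a := by
  rw [Finset.prod_univ_sum]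
  simp [labelMean, Finset.prod_mul_distrib]

lemma labelMean_one (M : SBM) {n : ℕ} : M.labelMean (fun _ : Fin n → Fin M.k => 1) = 1 := by
  have := M.labelMean_prod (n := n) (fun _ _ => 1)
  simpa [M.p_sum] using this

lemma labelMean_sum (M : SBM) {n : ℕ} {ι : Type*} (s : Finset ι)
    (F : ι → (Fin n → Fin M.k) → ℝ) :
    M.labelMean (fun x => ∑ i ∈ s, F i x) = ∑ i ∈ s, M.labelMean (F i) := by
  unfold labelMean
  rw [Finset.sum_comm]
  simp [Finset.mul_sum]

lemma labelMean_const_mul (M : SBM) {n : ℕ} (c : ℝ) (F : (Fin n → Fin M.k) → ℝ) :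
    M.labelMean (fun x => c * F x) = c * M.labelMean F := by
  unfold labelMean
  rw [Finset.mul_sum]
  exact Finset.sum_congr rfl fun x _ => by ring

/-- The mean of the character of `S`. -/
noncomputable def phi (M : SBM) {n : ℕ} (S : Finset (Sym2 (Fin n))) : ℝ :=
  M.labelMean fun x => ∏ e ∈ S, M.edgeWeight x e

lemma phi_empty (M : SBM) {n : ℕ} : M.phi (∅ : Finset (Sym2 (Fin n))) = 1 := by
  simpa [phi] using M.labelMean_one

lemma abs_prod_edgeWeight_le (M : SBM) {n : ℕ} (x : Fin n → Fin M.k)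
    (S : Finset (Sym2 (Fin n))) : |∏ e ∈ S, M.edgeWeight x e| ≤ 1 := by
  rw [Finset.abs_prod]
  exact Finset.prod_le_one (fun _ _ => abs_nonneg _) fun e _ => M.abs_edgeWeight_le x e

lemma phi_le_one (M : SBM) {n : ℕ} (S : Finset (Sym2 (Fin n))) : M.phi S ≤ 1 := by
  rw [← M.labelMean_one (n := n)]
  exact M.labelMean_mono fun x => (le_abs_self _).trans (M.abs_prod_edgeWeight_le x S)

open scoped Classical in
/-- The mean of a statistic. -/
noncomputable def expect (M : SBM) {n : ℕ} (f : SimpleGraph (Fin n) → ℝ) : ℝ :=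
  ∑ G, M.mass n G * f G

open scoped Classical in
lemma mass_eq (M : SBM) (n : ℕ) (G : SimpleGraph (Fin n)) :
    M.mass n G = M.labelMean fun x => ∏ e ∈ pairSet n,
      if e ∈ G.edgeSet then (1 + M.edgeWeight x e) / 2 else (1 - M.edgeWeight x e) / 2 := by
  unfold mass labelMean
  refine Finset.sum_congr rfl fun x _ => ?_
  refine congrArg _ (Eq.trans ?_ (prod_pairs _))
  simp

open scoped Classical in
/-- The mean of a character only depends on the conditional edge weights. -/
lemma expect_character (M : SBM) {n : ℕ} {S : Finset (Sym2 (Fin n))} (hS : S ⊆ pairSet n) :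
    M.expect (character S) = M.phi S := by
  unfold expect phi
  simp_rw [mass_eq, labelMean, Finset.sum_mul]
  rw [Finset.sum_comm]
  refine Finset.sum_congr rfl fun x _ => ?_
  simp_rw [mul_assoc]
  rw [← Finset.mul_sum]
  congr 1
  have h1 : ∀ G : SimpleGraph (Fin n), character S G =
      ∏ e ∈ pairSet n, if e ∈ S then spin G e else 1 := by
    intro G
    rw [Finset.prod_ite_mem, Finset.inter_eq_right.2 hS]; rfl
  simp_rw [h1, ← Finset.prod_mul_distrib]
  -- For fixed labels the sum over graphs factors over pairs: a pair in `S` contributes its weight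
  -- and any other pair contributes `1`.
  have h2 := sum_graph_prod (n := n)
    (fun e => (1 + M.edgeWeight x e) / 2)
    (fun e => (1 - M.edgeWeight x e) / 2 * if e ∈ S then -1 else 1)
  have h3 : ∏ e ∈ S, M.edgeWeight x e =
      ∏ e ∈ pairSet n, if e ∈ S then M.edgeWeight x e else 1 := by
    rw [Finset.prod_ite_mem, Finset.inter_eq_right.2 hS]
  rw [h3]
  convert h2 using 1
  · refine Finset.sum_congr rfl fun G _ => Finset.prod_congr rfl fun e _ => ?_
    unfold spin
    split_ifs <;> ring
  · refine Finset.prod_congr rfl fun e _ => ?_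
    split_ifs <;> ring

lemma mass_nonneg (M : SBM) (n : ℕ) (G : SimpleGraph (Fin n)) : 0 ≤ M.mass n G := by
  rw [mass_eq]
  refine Finset.sum_nonneg fun x _ => mul_nonneg (M.labelWeight_nonneg x)
    (Finset.prod_nonneg fun e _ => ?_)
  have := abs_le.1 (M.abs_edgeWeight_le x e)
  split_ifs <;> linarith

lemma expect_sum (M : SBM) {n : ℕ} {ι : Type*} (s : Finset ι)
    (f : ι → SimpleGraph (Fin n) → ℝ) :
    M.expect (fun G => ∑ i ∈ s, f i G) = ∑ i ∈ s, M.expect (f i) := by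
  unfold expect
  rw [Finset.sum_comm]
  simp [Finset.mul_sum]

lemma expect_const_mul (M : SBM) {n : ℕ} (c : ℝ) (f : SimpleGraph (Fin n) → ℝ) :
    M.expect (fun G => c * f G) = c * M.expect f := by
  unfold expect
  rw [Finset.mul_sum]
  exact Finset.sum_congr rfl fun x _ => by ring

end SBM

/-! ### Integrals and variances as finite sums; the null law as a block model. -/

instance (n : ℕ) : MeasurableSingletonClass (SimpleGraph (Fin n)) where
  measurableSet_singleton G := by
    have h := SimpleGraph.measurable_edgeSet (V := Fin n) (measurableSet_singleton G.edgeSet)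
    convert h
    ext G'
    simp

namespace SBM

instance (M : SBM) (n : ℕ) : IsProbabilityMeasure (M.law n) where
  measure_univ := by
    classical
    unfold law
    simp only [Measure.coe_finsetSum, Finset.sum_apply, Measure.smul_apply, measure_univ,
      smul_eq_mul, mul_one]
    rw [← ENNReal.ofReal_sum_of_nonneg fun G _ => M.mass_nonneg n G]
    have h := M.expect_character (Finset.empty_subset (pairSet n))
    rw [phi_empty] at h
    rw [ENNReal.ofReal_eq_one, ← h]
    unfold expect
    refine Finset.sum_congr (by congr!) fun G _ => by simp [character]

lemma integral_law (M : SBM) {n : ℕ} (f : SimpleGraph (Fin n) → ℝ) :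
    ∫ G, f G ∂(M.law n) = M.expect f := by
  classical
  unfold law
  rw [integral_finsetSum_measure]
  · unfold expect
    refine Finset.sum_congr (by congr!) fun G _ => ?_
    rw [integral_smul_measure, integral_dirac, ENNReal.toReal_ofReal (M.mass_nonneg n G),
      smul_eq_mul]
  · intro G _
    exact (Integrable.of_finite (μ := Measure.dirac G)).smul_measure (by simp)

lemma memLp_law (M : SBM) {n : ℕ} (f : SimpleGraph (Fin n) → ℝ) : MemLp f 2 (M.law n) :=
  ⟨.of_discrete, eLpNorm_lt_top_of_finite⟩

lemma variance_law (M : SBM) {n : ℕ} (f : SimpleGraph (Fin n) → ℝ) :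
    Var[f; M.law n] = M.expect (fun G => f G * f G) - M.expect f ^ 2 := by
  rw [variance_eq_sub (M.memLp_law f), integral_law, integral_law]
  simp [pow_two]; rfl

end SBM

/-- The block model with one community and edge probability `1/2`. -/
noncomputable def trivialSBM : SBM where
  k := 1
  p := fun _ => 1
  Q := 0
  p_nonneg := by simp
  p_sum := by simp
  Q_symm := Matrix.isSymm_zero
  Q_le := by simp

/-- Makes the null law the diagonal model with `Q = 0`, so that every bound for diagonal models also
covers the null side. -/
lemma nullLaw_eq (n : ℕ) : nullLaw n = trivialSBM.law n := by
  classical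
  refine Measure.ext_of_singleton fun G => ?_
  have hm : ∀ G : SimpleGraph (Fin n), trivialSBM.mass n G = (1 / 2) ^ (n.choose 2) := by
    intro G
    rw [SBM.mass_eq]
    have hc : (pairSet n).card = n.choose 2 := by
      rw [pairSet, ← Fintype.card_subtype, Sym2.card_subtype_not_diag, Fintype.card_fin]
    have h0 : ∀ (x : Fin n → Fin trivialSBM.k) e, trivialSBM.edgeWeight x e = 0 := by
      intro x e
      induction e with | _ i j
      rfl
    simp only [h0, add_zero, sub_zero, ite_self, Finset.prod_const, hc]
    have := trivialSBM.labelMean_const_mul ((1 / 2 : ℝ) ^ n.choose 2)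
      (fun _ : Fin n → Fin trivialSBM.k => 1)
    rw [SBM.labelMean_one] at this
    simpa using this
  have hle : G.edgeSet.ncard ≤ n.choose 2 := by
    have := G.card_edgeFinset_le_card_choose_two
    rw [Set.ncard_eq_toFinset_card' G.edgeSet]
    simpa only [SimpleGraph.edgeFinset, Fintype.card_fin] using this
  unfold nullLaw SBM.law
  rw [SimpleGraph.binomialRandom_singleton]
  simp only [Measure.coe_finsetSum, Finset.sum_apply, Measure.smul_apply, smul_eq_mul, hm,
    Measure.dirac_apply, Set.indicator, Set.mem_singleton_iff, Pi.one_apply, mul_ite, mul_one,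
    mul_zero, Finset.sum_ite_eq', Finset.mem_univ, if_true]
  have h1 : (unitInterval.toNNReal ⟨1 / 2, by norm_num, by norm_num⟩ : ENNReal) =
      ENNReal.ofReal (1 / 2) := by
    rw [ENNReal.ofReal]; congr 1; ext; simp
  have h2 : (unitInterval.toNNReal (unitInterval.symm ⟨1 / 2, by norm_num, by norm_num⟩) :
      ENNReal) = ENNReal.ofReal (1 / 2) := by
    rw [ENNReal.ofReal]; congr 1; ext; simp; norm_num
  rw [h1, h2, ← pow_add, Nat.card_fin, Nat.add_sub_cancel' hle,
    ENNReal.ofReal_pow (by norm_num)]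

/-! ### Low-degree polynomials in the character basis. -/

open scoped Classical in
/-- The sets of at most `D` pairs. -/
noncomputable def lowSets (n D : ℕ) : Finset (Finset (Sym2 (Fin n))) :=
  (pairSet n).powerset.filter fun S => S.card ≤ D

lemma mem_lowSets {n D : ℕ} {S : Finset (Sym2 (Fin n))} :
    S ∈ lowSets n D ↔ S ⊆ pairSet n ∧ S.card ≤ D := by
  simp [lowSets]

/-- A polynomial of degree at most `D` in the edge indicators is a combination of characters of
sets of at most `D` pairs. -/
lemma IsPolyDegreeLE.exists_eq_sum_character {D n : ℕ} {f : SimpleGraph (Fin n) → ℝ}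
    (hf : IsPolyDegreeLE D f) :
    ∃ c : Finset (Sym2 (Fin n)) → ℝ, ∀ G, f G = ∑ S ∈ lowSets n D, c S * character S G := by
  classical
  obtain ⟨P, hP, hf⟩ := hf
  suffices h : f ∈ Submodule.span ℝ (character '' (lowSets n D : Set (Finset (Sym2 (Fin n))))) by
    rw [Submodule.mem_span_image_finset_iff_exists_fun] at h
    obtain ⟨c, rfl⟩ := h
    refine ⟨fun S => if hS : S ∈ lowSets n D then c ⟨S, hS⟩ else 0, fun G => ?_⟩
    rw [← Finset.sum_attach (lowSets n D)]
    simp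
  -- Indicators are idempotent, so only the support of a monomial matters.
  have hsum : f = ∑ m ∈ P.support, P.coeff m • fun G : SimpleGraph (Fin n) =>
      ∏ e ∈ m.support, (if e.1 ∈ G.edgeSet then (1 : ℝ) else 0) := by
    funext G
    rw [hf, MvPolynomial.eval_eq]
    simp only [Finset.sum_apply, Pi.smul_apply, smul_eq_mul]
    refine Finset.sum_congr rfl fun m _ => ?_
    congr 1
    refine Finset.prod_congr (by congr!) fun e he => ?_
    rw [Finsupp.mem_support_iff] at he
    split_ifs <;> simp [he]
  rw [hsum]
  refine Submodule.sum_mem _ fun m hm => Submodule.smul_mem _ _ ?_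
  -- Each indicator is `(1 + spin) / 2`; expanding the product gives all characters of subsets of
  -- the support.
  have hprod : (fun G : SimpleGraph (Fin n) =>
      ∏ e ∈ m.support, (if e.1 ∈ G.edgeSet then (1 : ℝ) else 0)) =
      (1 / 2 : ℝ) ^ m.support.card • ∑ S ∈ (m.support.map (Function.Embedding.subtype _)).powerset,
        character S := by
    funext G
    have h1 : ∀ e : {e : Sym2 (Fin n) // ¬ e.IsDiag},
        (if e.1 ∈ G.edgeSet then (1 : ℝ) else 0) = (1 / 2) * (1 + spin G e.1) := by
      intro e; unfold spin; ring
    simp only [h1, Finset.prod_mul_distrib, Finset.prod_const, Pi.smul_apply, Finset.sum_apply,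
      smul_eq_mul]
    congr 1
    have := Finset.prod_map m.support (Function.Embedding.subtype _) fun e => 1 + spin G e
    simp only [Function.Embedding.subtype_apply] at this
    rw [← this, Finset.prod_one_add]
    rfl
  rw [hprod]
  refine Submodule.smul_mem _ _ (Submodule.sum_mem _ fun S hS => Submodule.subset_span ?_)
  refine ⟨S, ?_, rfl⟩
  rw [Finset.mem_powerset] at hS
  rw [Finset.mem_coe, mem_lowSets]
  constructor
  · intro e he
    obtain ⟨e', -, rfl⟩ := Finset.mem_map.1 (hS he)
    exact mem_pairSet.2 e'.2
  · calc S.card ≤ m.support.card := by simpa using Finset.card_le_card hS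
      _ ≤ m.sum fun _ k => k := by
        rw [Finsupp.sum, Finset.card_eq_sum_ones]
        exact Finset.sum_le_sum fun e he => Nat.one_le_iff_ne_zero.2 (Finsupp.mem_support_iff.1 he)
      _ ≤ P.totalDegree := MvPolynomial.le_totalDegree hm
      _ ≤ D := hP

lemma trivialSBM_phi {n : ℕ} {S : Finset (Sym2 (Fin n))} (hS : S.Nonempty) :
    trivialSBM.phi S = 0 := by
  obtain ⟨e, he⟩ := hS
  have h0 : ∀ x : Fin n → Fin trivialSBM.k, ∏ e ∈ S, trivialSBM.edgeWeight x e = 0 := by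
    intro x
    refine Finset.prod_eq_zero he ?_
    induction e with | _ i j
    rfl
  simp [SBM.phi, SBM.labelMean, h0]

lemma symmDiff_subset_pairSet {n : ℕ} {S T : Finset (Sym2 (Fin n))} (hS : S ⊆ pairSet n)
    (hT : T ⊆ pairSet n) : symmDiff S T ⊆ pairSet n := fun e he => by
  rcases Finset.mem_symmDiff.1 he with h | h
  exacts [hS h.1, hT h.1]

/-- The low-degree bound: Cauchy-Schwarz in the Fourier basis. -/
lemma sq_expect_sub_le (M : SBM) {n D : ℕ} {f : SimpleGraph (Fin n) → ℝ}
    (hf : IsPolyDegreeLE D f) :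
    (trivialSBM.expect f - M.expect f) ^ 2 ≤
      Var[f; trivialSBM.law n] * ∑ S ∈ (lowSets n D).erase ∅, M.phi S ^ 2 := by
  classical
  obtain ⟨c, hc⟩ := hf.exists_eq_sum_character
  have hmem : ∅ ∈ lowSets n D := mem_lowSets.2 ⟨Finset.empty_subset _, by simp⟩
  have hE : ∀ M : SBM, M.expect f = c ∅ + ∑ S ∈ (lowSets n D).erase ∅, c S * M.phi S := by
    intro M
    have h : f = fun G => ∑ S ∈ lowSets n D, c S * character S G := funext hc
    rw [h, M.expect_sum, ← Finset.add_sum_erase _ _ hmem]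
    congr 1
    · rw [M.expect_const_mul, M.expect_character (Finset.empty_subset _), M.phi_empty, mul_one]
    · refine Finset.sum_congr rfl fun S hS => ?_
      rw [M.expect_const_mul, M.expect_character (mem_lowSets.1 (Finset.mem_of_mem_erase hS)).1]
  have hE0 : trivialSBM.expect f = c ∅ := by
    rw [hE, Finset.sum_eq_zero, add_zero]
    intro S hS
    rw [trivialSBM_phi (Finset.nonempty_of_ne_empty (Finset.ne_of_mem_erase hS)), mul_zero]
  have hV : Var[f; trivialSBM.law n] = ∑ S ∈ (lowSets n D).erase ∅, c S ^ 2 := by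
    rw [SBM.variance_law, hE0]
    have h : (fun G => f G * f G) = fun G => ∑ S ∈ lowSets n D, ∑ T ∈ lowSets n D,
        c S * c T * character (symmDiff S T) G := by
      funext G
      rw [hc, Finset.sum_mul_sum]
      refine Finset.sum_congr rfl fun S _ => Finset.sum_congr rfl fun T _ => ?_
      rw [← character_mul]; ring
    have h2 : trivialSBM.expect (fun G => f G * f G) = ∑ S ∈ lowSets n D, c S ^ 2 := by
      rw [h, SBM.expect_sum]
      refine Finset.sum_congr rfl fun S hS => ?_
      rw [SBM.expect_sum, Finset.sum_eq_single S]
      · rw [SBM.expect_const_mul, symmDiff_self, Finset.bot_eq_empty,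
          SBM.expect_character _ (Finset.empty_subset _), SBM.phi_empty]
        ring
      · intro T hT hTS
        rw [SBM.expect_const_mul, SBM.expect_character _ (symmDiff_subset_pairSet
          (mem_lowSets.1 hS).1 (mem_lowSets.1 hT).1), trivialSBM_phi, mul_zero]
        rw [Finset.nonempty_iff_ne_empty, ← Finset.bot_eq_empty, Ne, symmDiff_eq_bot]
        exact fun h => hTS h.symm
      · exact fun h => absurd hS h
    rw [h2, ← Finset.add_sum_erase _ _ hmem]
    ring
  rw [hE0, hE M, hV]
  have := Finset.sum_mul_sq_le_sq_mul_sq ((lowSets n D).erase ∅) c M.phi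
  calc _ = (∑ S ∈ (lowSets n D).erase ∅, c S * M.phi S) ^ 2 := by ring
    _ ≤ _ := this

/-! ### Bounding the low-degree advantage in a diagonal model. -/

namespace SBM

/-- The moments `∑ p_a ^ v q_a ^ j` of the diagonal of the model. -/
noncomputable def diagMoment (M : SBM) (v j : ℕ) : ℝ := ∑ a, M.p a ^ v * M.Q a a ^ j

lemma p_le_one (M : SBM) (a : Fin M.k) : M.p a ≤ 1 := by
  rw [← M.p_sum]
  exact Finset.single_le_sum (fun a _ => M.p_nonneg a) (Finset.mem_univ a)

open scoped Classical in
/-- In a diagonal model the mean of a character factors over connected components. -/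
lemma phi_eq_prod_components (M : SBM) (hM : M.Q.IsDiag) {n : ℕ} {S : Finset (Sym2 (Fin n))}
    (hS : S ⊆ pairSet n) :
    M.phi S = ∏ c : (SimpleGraph.fromEdgeSet (S : Set (Sym2 (Fin n)))).ConnectedComponent,
      M.diagMoment (Fintype.card c.supp) c.toSimpleGraph.edgeFinset.card := by
  set H := SimpleGraph.fromEdgeSet (S : Set (Sym2 (Fin n))) with hH
  have hadj : ∀ i j, s(i, j) ∈ S ↔ H.Adj i j := by
    intro i j
    rw [hH, SimpleGraph.fromEdgeSet_adj]
    refine ⟨fun h => ⟨h, ?_⟩, fun h => h.1⟩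
    simpa using mem_pairSet.1 (hS h)
  -- The component of an arbitrary endpoint; for a pair in `S` both endpoints give the same one, and
  -- other pairs are never used.
  let g : Sym2 (Fin n) → H.ConnectedComponent := fun e => H.connectedComponentMk (Quot.out e).1
  have hg : ∀ i j, s(i, j) ∈ S → g s(i, j) = H.connectedComponentMk i ∧
      g s(i, j) = H.connectedComponentMk j := by
    intro i j hij
    have hc : H.connectedComponentMk i = H.connectedComponentMk j :=
      SimpleGraph.ConnectedComponent.connectedComponentMk_eq_of_adj ((hadj i j).1 hij)
    have hm : (Quot.out s(i, j)).1 ∈ s(i, j) := Sym2.out_fst_mem _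
    rcases Sym2.mem_iff.1 hm with h | h
    · simp only [g, h, hc, and_self]
    · simp only [g, h, hc, and_self]
  have hcard : ∀ c : H.ConnectedComponent,
      (S.filter fun e => g e = c).card = c.toSimpleGraph.edgeFinset.card := by
    intro c
    have h := congrArg Finset.card (SimpleGraph.map_edgeFinset_induce (G := H) (s := c.supp))
    rw [Finset.card_map] at h
    have h' : c.toSimpleGraph.edgeFinset.card = (H.induce c.supp).edgeFinset.card := by
      congr!
    rw [h', h]
    congr 1
    ext e
    induction e with | _ i j
    simp only [Finset.mem_filter, Finset.mem_inter, SimpleGraph.mem_edgeFinset,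
      SimpleGraph.mem_edgeSet, ← hadj, Finset.mk_mem_sym2_iff, Set.mem_toFinset,
      SimpleGraph.ConnectedComponent.mem_supp_iff]
    refine and_congr_right fun hij => ?_
    obtain ⟨h1, h2⟩ := hg i j hij
    rw [← h1, ← h2, and_self]
  -- Expanding the product of sums yields one label `y c` per component, that is, a labelling
  -- constant on components.
  have hR : ∏ c : H.ConnectedComponent,
      M.diagMoment (Fintype.card c.supp) c.toSimpleGraph.edgeFinset.card =
      ∑ y : H.ConnectedComponent → Fin M.k, (∏ i, M.p (y (H.connectedComponentMk i))) *
        ∏ e ∈ S, M.edgeWeight (fun i => y (H.connectedComponentMk i)) e := by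
    unfold diagMoment
    rw [Finset.prod_univ_sum]
    rw [Fintype.piFinset_univ]
    refine Finset.sum_congr rfl fun y _ => ?_
    rw [Finset.prod_mul_distrib]
    congr 1
    · rw [← Finset.prod_fiberwise Finset.univ H.connectedComponentMk
        (fun i => M.p (y (H.connectedComponentMk i)))]
      refine Finset.prod_congr rfl fun c _ => ?_
      rw [Finset.prod_congr rfl (g := fun _ => M.p (y c)), Finset.prod_const]
      · congr 1
        rw [Fintype.card_subtype]
        simp only [SimpleGraph.ConnectedComponent.mem_supp_iff]
      · intro i hi
        rw [(Finset.mem_filter.1 hi).2]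
    · rw [← Finset.prod_fiberwise S g]
      refine Finset.prod_congr rfl fun c _ => ?_
      rw [Finset.prod_congr rfl (g := fun _ => M.Q (y c) (y c)), Finset.prod_const, hcard]
      intro e he
      induction e with | _ i j
      obtain ⟨he, hc⟩ := Finset.mem_filter.1 he
      obtain ⟨h1, h2⟩ := hg i j he
      rw [edgeWeight_mk, ← h1, ← h2, hc]
  rw [hR]
  unfold phi labelMean
  symm
  -- A labelling that is not constant on components is bichromatic on some pair of `S`, and its term
  -- vanishes.
  refine Finset.sum_of_injOn (fun y i => y (H.connectedComponentMk i)) ?_ (by simp) ?_ ?_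
  · intro y _ y' _ h
    funext c
    induction c using SimpleGraph.ConnectedComponent.ind with | _ i
    exact congrFun h i
  · intro x _ hx
    rw [mul_eq_zero]
    right
    by_contra hne
    apply hx
    have hcon : ∀ i j, H.Adj i j → x i = x j := by
      intro i j hij
      by_contra hxne
      refine hne (Finset.prod_eq_zero ((hadj i j).2 hij) ?_)
      rw [edgeWeight_mk]
      exact hM hxne
    have hwalk : ∀ i j, ∀ w : H.Walk i j, x i = x j := by
      intro i j w
      induction w with
      | nil => rfl
      | cons h _ ih => exact (hcon _ _ h).trans ih
    refine ⟨fun c => SimpleGraph.ConnectedComponent.lift x (fun i j w _ => hwalk i j w) c,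
      by simp, ?_⟩
    funext i
    simp
  · intro y _; rfl

lemma abs_diagMoment_le_one (M : SBM) {v : ℕ} (hv : 1 ≤ v) (j : ℕ) :
    |M.diagMoment v j| ≤ 1 := by
  rw [← M.p_sum]
  refine (Finset.abs_sum_le_sum_abs _ _).trans (Finset.sum_le_sum fun a _ => ?_)
  rw [abs_mul, abs_pow, abs_pow, abs_of_nonneg (M.p_nonneg a)]
  calc M.p a ^ v * |M.Q a a| ^ j ≤ M.p a ^ v * 1 :=
        mul_le_mul_of_nonneg_left (pow_le_one₀ (abs_nonneg _) (M.Q_le a a))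
          (pow_nonneg (M.p_nonneg a) _)
    _ ≤ M.p a := by
        rw [mul_one]
        exact pow_le_of_le_one (M.p_nonneg a) (M.p_le_one a) (by omega)

lemma diagMoment_nonneg (M : SBM) (v : ℕ) {j : ℕ} (hj : Even j) : 0 ≤ M.diagMoment v j :=
  Finset.sum_nonneg fun a _ => mul_nonneg (pow_nonneg (M.p_nonneg a) _) (hj.pow_nonneg _)

/-- Moments of connected graphs with at least three vertices are controlled by the wedge. -/
lemma abs_diagMoment_le_pow (M : SBM) {r : ℝ} (hr : 0 ≤ r) (hw : M.diagMoment 3 2 ≤ r ^ 3)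
    {v j : ℕ} (hv : 3 ≤ v) (hj : v ≤ j + 1) : |M.diagMoment v j| ≤ r ^ v := by
  have hterm : ∀ a, 0 ≤ M.p a ^ 3 * M.Q a a ^ 2 := fun a =>
    mul_nonneg (pow_nonneg (M.p_nonneg a) _) (sq_nonneg _)
  -- From `(p |q|)³ ≤ p³ q² ≤ w`; beyond the first three vertices each vertex then brings a factor
  -- `p |q|`.
  have hpq : ∀ a, M.p a * |M.Q a a| ≤ r := by
    intro a
    refine le_of_pow_le_pow_left₀ (n := 3) (by norm_num) hr ?_
    calc (M.p a * |M.Q a a|) ^ 3 = M.p a ^ 3 * |M.Q a a| ^ 2 * |M.Q a a| := by ring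
      _ ≤ M.p a ^ 3 * |M.Q a a| ^ 2 * 1 :=
        mul_le_mul_of_nonneg_left (M.Q_le a a) (by rw [sq_abs]; exact hterm a)
      _ = M.p a ^ 3 * M.Q a a ^ 2 := by rw [sq_abs, mul_one]
      _ ≤ M.diagMoment 3 2 :=
        Finset.single_le_sum (f := fun a => M.p a ^ 3 * M.Q a a ^ 2) (fun a _ => hterm a)
          (Finset.mem_univ a)
      _ ≤ r ^ 3 := hw
  obtain ⟨k, rfl⟩ := Nat.exists_eq_add_of_le hv
  calc |M.diagMoment (3 + k) j| ≤ ∑ a, M.p a ^ 3 * M.Q a a ^ 2 * r ^ k := by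
        refine (Finset.abs_sum_le_sum_abs _ _).trans (Finset.sum_le_sum fun a _ => ?_)
        rw [abs_mul, abs_pow, abs_pow, abs_of_nonneg (M.p_nonneg a)]
        calc M.p a ^ (3 + k) * |M.Q a a| ^ j ≤ M.p a ^ (3 + k) * |M.Q a a| ^ (2 + k) :=
              mul_le_mul_of_nonneg_left
                (pow_le_pow_of_le_one (abs_nonneg _) (M.Q_le a a) (by omega))
                (pow_nonneg (M.p_nonneg a) _)
          _ = M.p a ^ 3 * M.Q a a ^ 2 * (M.p a * |M.Q a a|) ^ k := by
              rw [← sq_abs (M.Q a a)]; ring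
          _ ≤ M.p a ^ 3 * M.Q a a ^ 2 * r ^ k :=
              mul_le_mul_of_nonneg_left (pow_le_pow_left₀
                (mul_nonneg (M.p_nonneg a) (abs_nonneg _)) (hpq a) k) (hterm a)
    _ = M.diagMoment 3 2 * r ^ k := by rw [← Finset.sum_mul]; rfl
    _ ≤ r ^ 3 * r ^ k := mul_le_mul_of_nonneg_right hw (pow_nonneg hr k)
    _ = r ^ (3 + k) := by ring

open scoped Classical in
/-- Each vertex touched by `S` costs a factor of at most `r ^ 2`. -/
lemma sq_phi_le (M : SBM) (hM : M.Q.IsDiag) {n : ℕ} {r : ℝ} (hr : 0 ≤ r)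
    (he : |M.diagMoment 2 1| ≤ r ^ 2) (hw : M.diagMoment 3 2 ≤ r ^ 3)
    {S : Finset (Sym2 (Fin n))} (hS : S ⊆ pairSet n) :
    M.phi S ^ 2 ≤ (r ^ 2) ^ (Finset.univ.filter fun i : Fin n => ∃ e ∈ S, i ∈ e).card := by
  rw [M.phi_eq_prod_components hM hS]
  set H := SimpleGraph.fromEdgeSet (S : Set (Sym2 (Fin n))) with hH
  have h1 : (r ^ 2) ^ (Finset.univ.filter fun i : Fin n => ∃ e ∈ S, i ∈ e).card =
      ∏ i : Fin n, if ∃ e ∈ S, i ∈ e then r ^ 2 else 1 := by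
    rw [Finset.prod_ite, Finset.prod_const_one, mul_one, Finset.prod_const]
  rw [h1, ← Finset.prod_fiberwise Finset.univ H.connectedComponentMk, ← Finset.prod_pow]
  refine Finset.prod_le_prod (fun _ _ => sq_nonneg _) fun c _ => ?_
  have hcard : (Finset.univ.filter fun i => H.connectedComponentMk i = c).card =
      Fintype.card c.supp := by
    rw [Fintype.card_subtype]
    simp only [SimpleGraph.ConnectedComponent.mem_supp_iff]
    rfl
  obtain ⟨i₀, hi₀⟩ : ∃ i, H.connectedComponentMk i = c := c.exists_rep
  have hpos : 1 ≤ Fintype.card c.supp := by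
    rw [← hcard]
    exact Finset.card_pos.2 ⟨i₀, by simpa using hi₀⟩
  have hle : Fintype.card c.supp ≤ c.toSimpleGraph.edgeFinset.card + 1 := by
    have := c.connected_toSimpleGraph.card_vert_le_card_edgeSet_add_one
    rw [Nat.card_eq_fintype_card (α := c.toSimpleGraph.edgeSet),
      ← SimpleGraph.edgeFinset_card] at this
    rw [← Nat.card_eq_fintype_card (α := c.supp)]
    exact this
  -- A one-vertex component is untouched by `S` and only has to be at most `1`. In a larger
  -- component every vertex is touched.
  rcases hpos.eq_or_lt with h | h
  · obtain ⟨i, hi⟩ := Finset.card_eq_one.1 (hcard.trans h.symm)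
    have hi' : ¬ ∃ e ∈ S, i ∈ e := by
      rintro ⟨e, he, hie⟩
      obtain ⟨j, rfl⟩ := Sym2.mem_iff_exists.1 hie
      have hij : i ≠ j := by simpa using mem_pairSet.1 (hS he)
      have hadj : H.Adj i j := by rw [hH, SimpleGraph.fromEdgeSet_adj]; exact ⟨he, hij⟩
      have hic : H.connectedComponentMk i = c := by
        have : i ∈ Finset.univ.filter fun i => H.connectedComponentMk i = c := by simp [hi]
        simpa using this
      have : j ∈ Finset.univ.filter fun i => H.connectedComponentMk i = c := by
        simp [← hic, (SimpleGraph.ConnectedComponent.connectedComponentMk_eq_of_adj hadj)]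
      rw [hi, Finset.mem_singleton] at this
      exact hij this.symm
    rw [hi, Finset.prod_singleton, if_neg hi', sq_le_one_iff_abs_le_one]
    exact M.abs_diagMoment_le_one h.le _
  · have h2 : ∏ i with H.connectedComponentMk i = c, (if ∃ e ∈ S, i ∈ e then r ^ 2 else 1) =
        (r ^ Fintype.card c.supp) ^ 2 := by
      rw [← pow_mul, mul_comm, pow_mul, ← hcard, ← Finset.prod_const]
      refine Finset.prod_congr rfl fun i hi => if_pos ?_
      rw [← hcard, Finset.one_lt_card] at h
      obtain ⟨a, ha, b, hb, hab⟩ := h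
      obtain ⟨j, hj, hij⟩ : ∃ j, H.connectedComponentMk j = c ∧ i ≠ j := by
        by_cases hia : i = a
        · exact ⟨b, by simpa using hb, hia ▸ hab⟩
        · exact ⟨a, by simpa using ha, hia⟩
      have hreach : H.Reachable i j :=
        SimpleGraph.ConnectedComponent.exact ((Finset.mem_filter.1 hi).2.trans hj.symm)
      obtain ⟨w⟩ := hreach
      cases w with
      | nil => exact absurd rfl hij
      | cons hadj _ =>
        rw [hH, SimpleGraph.fromEdgeSet_adj] at hadj
        exact ⟨_, hadj.1, Sym2.mem_mk_left _ _⟩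
    rw [h2, ← sq_abs]
    refine pow_le_pow_left₀ (abs_nonneg _) ?_ 2
    -- Two vertices carry exactly one edge, whose moment may be negative and is bounded separately;
    -- from three vertices on the wedge moment suffices.
    rcases (show 2 ≤ Fintype.card c.supp from h).eq_or_lt with h3 | h3
    · have hE : c.toSimpleGraph.edgeFinset.card = 1 := by
        have h4 := c.toSimpleGraph.card_edgeFinset_le_card_choose_two
        have h5 : Fintype.card c = 2 := by
          rw [← Nat.card_eq_fintype_card] at h3 ⊢
          exact h3.symm
        rw [h5] at h4
        norm_num at h4
        omega
      rw [hE, ← h3]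
      exact he
    · exact M.abs_diagMoment_le_pow hr hw h3 hle

open scoped Classical in
/-- The low-degree advantage is bounded when the edge and wedge moments are small. -/
lemma sum_sq_phi_le (M : SBM) (hM : M.Q.IsDiag) {n D : ℕ} {r : ℝ} (hr : 0 ≤ r)
    (he : |M.diagMoment 2 1| ≤ r ^ 2) (hw : M.diagMoment 3 2 ≤ r ^ 3) :
    ∑ S ∈ lowSets n D, M.phi S ^ 2 ≤
      2 ^ (2 * D + 1).choose 2 * ∑ u ∈ Finset.range (2 * D + 1), (n * r ^ 2) ^ u := by
  let supp : Finset (Sym2 (Fin n)) → Finset (Fin n) := fun S =>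
    Finset.univ.filter fun i : Fin n => ∃ e ∈ S, i ∈ e
  have hcard : ∀ S ∈ lowSets n D, (supp S).card ≤ 2 * D := by
    intro S hS
    have hsub : supp S ⊆ S.biUnion fun e => Finset.univ.filter (· ∈ e) := by
      intro i hi
      obtain ⟨e, he, hie⟩ := (Finset.mem_filter.1 hi).2
      exact Finset.mem_biUnion.2 ⟨e, he, by simpa using hie⟩
    refine (Finset.card_le_card hsub).trans (Finset.card_biUnion_le.trans ?_)
    calc ∑ e ∈ S, (Finset.univ.filter (· ∈ e)).card ≤ ∑ e ∈ S, 2 := by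
          refine Finset.sum_le_sum fun e _ => ?_
          induction e with | _ i j
          have : (Finset.univ.filter (· ∈ s(i, j)) : Finset (Fin n)) = {i, j} := by
            ext; simp
          rw [this]
          exact Finset.card_le_two
      _ ≤ 2 * D := by
          rw [Finset.sum_const, smul_eq_mul, mul_comm]
          exact Nat.mul_le_mul_left 2 (mem_lowSets.1 hS).2
  have hfib : ∀ U : Finset (Fin n), U.card ≤ 2 * D →
      (((lowSets n D).filter fun S => supp S = U).card : ℝ) ≤ 2 ^ (2 * D + 1).choose 2 := by
    intro U hU
    -- Every pair of `S` lies inside its vertex support. Loops are counted in `sym2` too, hence `(2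
    -- * D + 1).choose 2` in the exponent.
    have hsub : ((lowSets n D).filter fun S => supp S = U) ⊆ U.sym2.powerset := by
      intro S hS
      obtain ⟨-, rfl⟩ := Finset.mem_filter.1 hS
      refine Finset.mem_powerset.2 fun e he => Finset.mem_sym2_iff.2 fun i hi => ?_
      exact Finset.mem_filter.2 ⟨Finset.mem_univ _, e, he, hi⟩
    have h := Finset.card_le_card hsub
    rw [Finset.card_powerset, Finset.card_sym2] at h
    have h2 : 2 ^ (U.card + 1).choose 2 ≤ 2 ^ (2 * D + 1).choose 2 :=
      Nat.pow_le_pow_right (by norm_num) (Nat.choose_le_choose 2 (by omega))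
    exact_mod_cast h.trans h2
  let 𝒰 : Finset (Finset (Fin n)) := Finset.univ.filter fun U => U.card ≤ 2 * D
  calc ∑ S ∈ lowSets n D, M.phi S ^ 2 ≤ ∑ S ∈ lowSets n D, (r ^ 2) ^ (supp S).card :=
        Finset.sum_le_sum fun S hS => M.sq_phi_le hM hr he hw (mem_lowSets.1 hS).1
    _ = ∑ U ∈ 𝒰, ∑ S ∈ lowSets n D with supp S = U, (r ^ 2) ^ (supp S).card := by
        rw [Finset.sum_fiberwise_of_maps_to]
        intro S hS
        simpa [𝒰] using hcard S hS
    _ ≤ ∑ U ∈ 𝒰, 2 ^ (2 * D + 1).choose 2 * (r ^ 2) ^ U.card := by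
        refine Finset.sum_le_sum fun U hU => ?_
        rw [Finset.sum_congr rfl (g := fun _ => (r ^ 2) ^ U.card), Finset.sum_const,
          nsmul_eq_mul]
        · exact mul_le_mul_of_nonneg_right (hfib U (by simpa [𝒰] using hU)) (by positivity)
        · intro S hS
          rw [(Finset.mem_filter.1 hS).2]
    _ = 2 ^ (2 * D + 1).choose 2 * ∑ U ∈ 𝒰, (r ^ 2) ^ U.card := by rw [Finset.mul_sum]
    _ ≤ _ := by
        refine mul_le_mul_of_nonneg_left ?_ (by positivity)
        rw [← Finset.sum_fiberwise_of_maps_to (s := 𝒰) (t := Finset.range (2 * D + 1))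
          (g := Finset.card) (fun U hU => by
            simp only [𝒰, Finset.mem_filter, Finset.mem_univ, true_and] at hU
            simp; omega)]
        refine Finset.sum_le_sum fun u _ => ?_
        rw [Finset.sum_congr rfl (g := fun _ => (r ^ 2) ^ u), Finset.sum_const, nsmul_eq_mul,
          mul_pow]
        · refine mul_le_mul_of_nonneg_right ?_ (by positivity)
          have hsub : (𝒰.filter fun U => U.card = u) ⊆ Finset.powersetCard u Finset.univ := by
            intro U hU
            simpa using (Finset.mem_filter.1 hU).2
          have h := Finset.card_le_card hsub
          rw [Finset.card_powersetCard, Finset.card_fin] at h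
          exact_mod_cast h.trans (Nat.choose_le_pow n u)
        · intro U hU
          rw [(Finset.mem_filter.1 hU).2]

end SBM

/-! ### Labelled copies, subgraphs and stars. -/

section Copies

variable {V : Type*} {n : ℕ}

/-- The copy of `H` in the complete graph given by an embedding of its vertices. -/
def embeddingCopy (H : SimpleGraph V) (φ : V ↪ Fin n) : H.Copy (⊤ : SimpleGraph (Fin n)) :=
  ⟨⟨φ, fun h => by simpa using h.ne⟩, φ.injective⟩

lemma toSubgraph_coe_iso {H : SimpleGraph V} {A : (⊤ : SimpleGraph (Fin n)).Subgraph}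
    (e : H ≃g A.coe) :
    (embeddingCopy H (e.toEquiv.toEmbedding.trans (Function.Embedding.subtype _))).toSubgraph
      = A := by
  have hv : ∀ v, (e.toEquiv.toEmbedding.trans (Function.Embedding.subtype (· ∈ A.verts))) v =
      (e v : Fin n) := fun v => rfl
  ext u v
  · constructor
    · rintro ⟨a, -, rfl⟩
      exact (e a).2
    · intro hu
      refine ⟨e.symm ⟨u, hu⟩, trivial, ?_⟩
      change ((e (e.symm ⟨u, hu⟩)) : Fin n) = u
      simp
  · constructor
    · rintro ⟨a, b, hab, rfl, rfl⟩
      exact e.map_rel_iff.2 hab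
    · intro h
      refine ⟨e.symm ⟨u, h.fst_mem⟩, e.symm ⟨v, h.snd_mem⟩, ?_, ?_, ?_⟩
      · change H.Adj _ _
        rw [e.symm.map_adj_iff]
        exact h
      · change ((e (e.symm ⟨u, _⟩)) : Fin n) = u
        simp
      · change ((e (e.symm ⟨v, _⟩)) : Fin n) = v
        simp

-- The embeddings with image `A` are the isomorphisms from `H` to `A`, and composing with a fixed
-- one identifies these with the automorphisms of `H`.
open scoped Classical in
lemma card_embedding_fiber [Fintype V] (H : SimpleGraph V)
    {A : (⊤ : SimpleGraph (Fin n)).Subgraph} (hA : Nonempty (H ≃g A.coe)) :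
    (Finset.univ.filter fun φ : V ↪ Fin n => (embeddingCopy H φ).toSubgraph = A).card =
      Nat.card (H ≃g H) := by
  have h1 : Nat.card (H ≃g H) = Nat.card (H ≃g A.coe) := by
    obtain ⟨e₀⟩ := hA
    exact Nat.card_congr
      { toFun := fun σ => σ.trans e₀
        invFun := fun e => e.trans e₀.symm
        left_inv := fun σ => by ext; simp
        right_inv := fun e => by ext; simp }
  rw [h1, ← Fintype.card_subtype, ← Nat.card_eq_fintype_card]
  symm
  refine Nat.card_eq_of_bijective (fun e : H ≃g A.coe =>
    (⟨e.toEquiv.toEmbedding.trans (Function.Embedding.subtype _), toSubgraph_coe_iso e⟩ :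
      {φ : V ↪ Fin n // (embeddingCopy H φ).toSubgraph = A})) ⟨?_, ?_⟩
  · intro e e' h
    exact DFunLike.ext _ _ fun v => Subtype.ext (DFunLike.congr_fun (Subtype.ext_iff.1 h) v)
  · rintro ⟨φ, rfl⟩
    exact ⟨(embeddingCopy H φ).isoToSubgraph, rfl⟩

open scoped Classical in
/-- A sum over labelled copies of `H` counts each copy once per automorphism. -/
lemma sum_embedding_eq [Fintype V] (H : SimpleGraph V)
    (F : (⊤ : SimpleGraph (Fin n)).Subgraph → ℝ) :
    ∑ φ : V ↪ Fin n, F (embeddingCopy H φ).toSubgraph =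
      Nat.card (H ≃g H) * ∑ A : (⊤ : SimpleGraph (Fin n)).Subgraph with Nonempty (H ≃g A.coe),
        F A := by
  rw [← Finset.sum_fiberwise_of_maps_to (s := Finset.univ)
    (t := Finset.univ.filter fun A : (⊤ : SimpleGraph (Fin n)).Subgraph => Nonempty (H ≃g A.coe))
    (g := fun φ => (embeddingCopy H φ).toSubgraph), Finset.mul_sum]
  · refine Finset.sum_congr rfl fun A hA => ?_
    rw [Finset.sum_congr rfl (g := fun _ => F A), Finset.sum_const, nsmul_eq_mul,
      card_embedding_fiber H (Finset.mem_filter.1 hA).2]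
    intro φ hφ
    rw [(Finset.mem_filter.1 hφ).2]
  · intro φ _
    exact Finset.mem_filter.2 ⟨Finset.mem_univ _, ⟨(embeddingCopy H φ).isoToSubgraph⟩⟩

end Copies

/-- The edges of the star with centre `φ 0` and leaves `φ 1, …, φ t`. -/
def starEdges {t n : ℕ} (φ : Fin (t + 1) → Fin n) : Finset (Sym2 (Fin n)) :=
  Finset.univ.image fun j : Fin t => s(φ 0, φ j.succ)

lemma mem_starEdges {t n : ℕ} {φ : Fin (t + 1) → Fin n} {e : Sym2 (Fin n)} :
    e ∈ starEdges φ ↔ ∃ j : Fin t, s(φ 0, φ j.succ) = e := by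
  simp [starEdges]

lemma starEdge_injective {t n : ℕ} (φ : Fin (t + 1) ↪ Fin n) :
    Function.Injective fun j : Fin t => s(φ 0, φ j.succ) := by
  intro i j h
  simpa using h

lemma starEdges_subset {t n : ℕ} (φ : Fin (t + 1) ↪ Fin n) : starEdges φ ⊆ pairSet n := by
  intro e he
  obtain ⟨j, rfl⟩ := mem_starEdges.1 he
  rw [mem_pairSet]
  simp [(Fin.succ_ne_zero j).symm]

lemma card_starEdges {t n : ℕ} (φ : Fin (t + 1) ↪ Fin n) : (starEdges φ).card = t := by
  rw [starEdges, Finset.card_image_of_injective _ (starEdge_injective φ), Finset.card_fin]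

lemma mem_edgeSet_starCopy {t n : ℕ} (φ : Fin (t + 1) ↪ Fin n) (e : Sym2 (Fin n)) :
    e ∈ (embeddingCopy (starWithEdges t) φ).toSubgraph.edgeSet ↔ e ∈ starEdges φ := by
  induction e with | _ u v
  rw [SimpleGraph.Subgraph.mem_edgeSet, mem_starEdges]
  constructor
  · rintro ⟨a, b, hab, rfl, rfl⟩
    change (SimpleGraph.starGraph 0).Adj a b at hab
    rw [SimpleGraph.starGraph_adj] at hab
    obtain ⟨hne, rfl | rfl⟩ := hab
    · obtain ⟨j, rfl⟩ := Fin.exists_succ_eq.2 hne.symm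
      exact ⟨j, rfl⟩
    · obtain ⟨j, rfl⟩ := Fin.exists_succ_eq.2 hne
      exact ⟨j, Sym2.eq_swap⟩
  · rintro ⟨j, hj⟩
    have hadj : (starWithEdges t).Adj 0 j.succ := by
      unfold starWithEdges
      rw [SimpleGraph.starGraph_adj]
      exact ⟨(Fin.succ_ne_zero j).symm, Or.inl rfl⟩
    rcases Sym2.eq_iff.1 hj with ⟨rfl, rfl⟩ | ⟨rfl, rfl⟩
    · exact ⟨0, j.succ, hadj, rfl, rfl⟩
    · exact ⟨j.succ, 0, hadj.symm, rfl, rfl⟩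

/-- The sum of the characters of all labelled stars. -/
noncomputable def starSum (t : ℕ) {n : ℕ} (G : SimpleGraph (Fin n)) : ℝ :=
  ∑ φ : Fin (t + 1) ↪ Fin n, character (starEdges φ) G

/-- The number of automorphisms of the star. -/
noncomputable def starAut (t : ℕ) : ℕ := Nat.card (starWithEdges t ≃g starWithEdges t)

lemma starAut_pos (t : ℕ) : 0 < starAut t := by
  have : Finite (starWithEdges t ≃g starWithEdges t) := DFunLike.finite _
  have : Nonempty (starWithEdges t ≃g starWithEdges t) := ⟨SimpleGraph.Iso.refl⟩
  exact Nat.card_pos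

/-- The two statistics differ by a positive constant, which does not affect whether they
distinguish; moments are easier for the labelled sum. -/
lemma starSum_eq (t : ℕ) {n : ℕ} (G : SimpleGraph (Fin n)) :
    starSum t G = starAut t * signedCount (starWithEdges t) G := by
  classical
  have h := sum_embedding_eq (n := n) (starWithEdges t) (fun A =>
    ∏ e : Sym2 (Fin n) with e ∈ A.edgeSet, (2 * (if e ∈ G.edgeSet then (1 : ℝ) else 0) - 1))
  unfold starSum signedCount starAut
  rw [Finset.sum_congr rfl fun φ _ => ?_, h]
  unfold character spin
  refine Finset.prod_congr ?_ fun e _ => by congr!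
  ext e
  rw [Finset.mem_filter, mem_edgeSet_starCopy]
  simp

/-! ### Joint means of edges and stars in a diagonal model. -/

namespace SBM

open scoped Classical in
/-- The function of the labels equal to `g a` if all vertices of `U` have label `a`, and to `0` if
`U` is not monochromatic. -/
noncomputable def monoOn (M : SBM) {n : ℕ} (g : Fin M.k → ℝ) (U : Finset (Fin n))
    (x : Fin n → Fin M.k) : ℝ :=
  ∑ a, g a * if ∀ i ∈ U, x i = a then 1 else 0

open scoped Classical in
lemma monoOn_of_mem (M : SBM) {n : ℕ} (g : Fin M.k → ℝ) {U : Finset (Fin n)} {v : Fin n}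
    (hv : v ∈ U) (x : Fin n → Fin M.k) :
    M.monoOn g U x = if ∀ i ∈ U, x i = x v then g (x v) else 0 := by
  unfold monoOn
  rw [Finset.sum_eq_single (x v)]
  · split_ifs <;> simp
  · intro a _ ha
    rw [if_neg fun h => ha (h v hv).symm, mul_zero]
  · simp

/-- A common vertex forces the two monochromatic sets to have the same colour, so the union is
monochromatic. -/
lemma monoOn_mul (M : SBM) {n : ℕ} (g h : Fin M.k → ℝ) {U V : Finset (Fin n)}
    (hUV : ¬ Disjoint U V) (x : Fin n → Fin M.k) :
    M.monoOn g U x * M.monoOn h V x = M.monoOn (g * h) (U ∪ V) x := by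
  obtain ⟨v, hU, hV⟩ := Finset.not_disjoint_iff.1 hUV
  rw [M.monoOn_of_mem g hU, M.monoOn_of_mem h hV,
    M.monoOn_of_mem (g * h) (Finset.mem_union_left V hU)]
  by_cases h1 : ∀ i ∈ U, x i = x v
  · by_cases h2 : ∀ i ∈ V, x i = x v
    · rw [if_pos h1, if_pos h2, if_pos, Pi.mul_apply]
      intro i hi
      exact (Finset.mem_union.1 hi).elim (h1 i) (h2 i)
    · rw [if_neg h2, mul_zero, if_neg]
      exact fun h => h2 fun i hi => h i (Finset.mem_union_right U hi)
  · rw [if_neg h1, zero_mul, if_neg]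
    exact fun h => h1 fun i hi => h i (Finset.mem_union_left V hi)

open scoped Classical in
lemma labelMean_indicator (M : SBM) {n : ℕ} {U V : Finset (Fin n)} (hUV : Disjoint U V)
    (a b : Fin M.k) :
    M.labelMean (fun x => (if ∀ i ∈ U, x i = a then 1 else 0) *
      (if ∀ i ∈ V, x i = b then (1 : ℝ) else 0)) = M.p a ^ U.card * M.p b ^ V.card := by
  have h1 : ∀ (W : Finset (Fin n)) (c : Fin M.k) (x : Fin n → Fin M.k),
      (if ∀ i ∈ W, x i = c then (1 : ℝ) else 0) =
        ∏ i, if i ∈ W then (if x i = c then 1 else 0) else 1 := by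
    intro W c x
    split_ifs with h
    · exact (Finset.prod_eq_one fun i _ => by
        split_ifs with h1 h2
        · rfl
        · exact absurd (h i h1) h2
        · rfl).symm
    · push Not at h
      obtain ⟨i, hi, hx⟩ := h
      exact (Finset.prod_eq_zero (Finset.mem_univ i) (by simp [hi, hx])).symm
  simp_rw [h1, ← Finset.prod_mul_distrib]
  rw [M.labelMean_prod (fun i α => (if i ∈ U then (if α = a then 1 else 0) else 1) *
    (if i ∈ V then (if α = b then 1 else 0) else 1))]
  have h2 : ∀ (W : Finset (Fin n)) (c : ℝ), c ^ W.card = ∏ i, if i ∈ W then c else 1 := by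
    intro W c
    rw [Finset.prod_ite_mem, Finset.univ_inter, Finset.prod_const]
  rw [h2, h2, ← Finset.prod_mul_distrib]
  refine Finset.prod_congr rfl fun i _ => ?_
  by_cases hU : i ∈ U
  · have hV : i ∉ V := Finset.disjoint_left.1 hUV hU
    simp [hU, hV]
  · by_cases hV : i ∈ V
    · simp [hU, hV]
    · simp [hU, hV, M.p_sum]

lemma labelMean_monoOn (M : SBM) {n : ℕ} (g : Fin M.k → ℝ) (U : Finset (Fin n)) :
    M.labelMean (M.monoOn g U) = ∑ a, g a * M.p a ^ U.card := by
  unfold monoOn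
  rw [M.labelMean_sum]
  refine Finset.sum_congr rfl fun a _ => ?_
  rw [M.labelMean_const_mul]
  have h := M.labelMean_indicator (Finset.disjoint_empty_right U) a a
  simp only [Finset.notMem_empty, false_imp_iff, implies_true, if_true, mul_one,
    Finset.card_empty, pow_zero] at h
  rw [h]

lemma labelMean_monoOn_mul (M : SBM) {n : ℕ} (g h : Fin M.k → ℝ) {U V : Finset (Fin n)}
    (hUV : Disjoint U V) :
    M.labelMean (fun x => M.monoOn g U x * M.monoOn h V x) =
      (∑ a, g a * M.p a ^ U.card) * ∑ a, h a * M.p a ^ V.card := by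
  unfold monoOn
  simp_rw [Finset.sum_mul_sum]
  rw [M.labelMean_sum]
  refine Finset.sum_congr rfl fun a _ => ?_
  rw [M.labelMean_sum]
  refine Finset.sum_congr rfl fun b _ => ?_
  have h1 := M.labelMean_indicator hUV a b
  calc _ = M.labelMean fun x => (g a * h b) * ((if ∀ i ∈ U, x i = a then 1 else 0) *
        (if ∀ i ∈ V, x i = b then (1 : ℝ) else 0)) := by
        congr 1; funext x; ring
    _ = _ := by rw [M.labelMean_const_mul, h1]; ring

lemma prod_starEdges_edgeWeight (M : SBM) (hM : M.Q.IsDiag) {t n : ℕ} (φ : Fin (t + 1) ↪ Fin n)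
    (x : Fin n → Fin M.k) :
    ∏ e ∈ starEdges φ, M.edgeWeight x e =
      M.monoOn (fun a => M.Q a a ^ t) (Finset.univ.map φ) x := by
  have h0 : φ 0 ∈ Finset.univ.map φ := by simp
  rw [M.monoOn_of_mem _ h0, starEdges, Finset.prod_image (starEdge_injective φ).injOn]
  simp only [edgeWeight_mk]
  split_ifs with h
  · rw [Finset.prod_congr rfl (g := fun _ => M.Q (x (φ 0)) (x (φ 0))), Finset.prod_const,
      Finset.card_fin]
    intro j _
    rw [h (φ j.succ) (by simp)]
  · push Not at h
    obtain ⟨i, hi, hx⟩ := h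
    obtain ⟨j, -, rfl⟩ := Finset.mem_map.1 hi
    obtain ⟨j, rfl⟩ := Fin.exists_succ_eq.2 (show j ≠ 0 by rintro rfl; exact hx rfl)
    exact Finset.prod_eq_zero (Finset.mem_univ j) (hM (Ne.symm hx))

lemma abs_edgeWeight_eq (M : SBM) (hM : M.Q.IsDiag) {n : ℕ} (e : Sym2 (Fin n))
    (x : Fin n → Fin M.k) :
    |M.edgeWeight x e| = M.monoOn (fun a => |M.Q a a|) e.toFinset x := by
  induction e with | _ i j
  rw [M.monoOn_of_mem _ (show i ∈ s(i, j).toFinset by simp), edgeWeight_mk]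
  split_ifs with h
  · rw [h j (by simp)]
  · rw [hM, abs_zero]
    intro hij
    apply h
    intro l hl
    rcases Sym2.mem_iff.1 (Sym2.mem_toFinset.1 hl) with rfl | rfl
    exacts [rfl, hij.symm]

/-- Two distinct edges are at most as correlated as those of a wedge. -/
lemma labelMean_abs_mul_abs_le (M : SBM) (hM : M.Q.IsDiag) {n : ℕ} {e f : Sym2 (Fin n)}
    (he : e ∈ pairSet n) (hf : f ∈ pairSet n) (hef : e ≠ f) :
    M.labelMean (fun x => |M.edgeWeight x e| * |M.edgeWeight x f|) ≤ M.diagMoment 3 2 := by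
  have hec := Sym2.card_toFinset_of_not_isDiag e (mem_pairSet.1 he)
  have hfc := Sym2.card_toFinset_of_not_isDiag f (mem_pairSet.1 hf)
  simp_rw [M.abs_edgeWeight_eq hM]
  by_cases hd : Disjoint e.toFinset f.toFinset
  · rw [M.labelMean_monoOn_mul _ _ hd, hec, hfc, ← sq]
    -- Cauchy-Schwarz: `(∑ p² |q|)² ≤ (∑ p) (∑ p³ q²)`.
    have h := Finset.sum_sq_le_sum_mul_sum_of_sq_le_mul Finset.univ
      (r := fun a => |M.Q a a| * M.p a ^ 2) (f := M.p) (g := fun a => M.p a ^ 3 * M.Q a a ^ 2)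
      (fun a _ => M.p_nonneg a)
      (fun a _ => mul_nonneg (pow_nonneg (M.p_nonneg a) _) (sq_nonneg _))
      (fun a _ => le_of_eq (by rw [mul_pow, sq_abs]; ring))
    rw [M.p_sum, one_mul] at h
    exact h
  · simp_rw [M.monoOn_mul _ _ hd]
    rw [M.labelMean_monoOn]
    -- Two distinct meeting pairs span at least three vertices, and further vertices only lower the
    -- moment because `p ≤ 1`.
    have hc : 3 ≤ (e.toFinset ∪ f.toFinset).card := by
      by_contra hlt
      have h1 := Finset.eq_of_subset_of_card_le
        (Finset.subset_union_left (s₁ := e.toFinset) (s₂ := f.toFinset)) (by omega)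
      have h2 := Finset.eq_of_subset_of_card_le
        (Finset.subset_union_right (s₁ := e.toFinset) (s₂ := f.toFinset)) (by omega)
      apply hef
      ext i
      rw [← Sym2.mem_toFinset, ← Sym2.mem_toFinset, h1, ← h2]
    refine Finset.sum_le_sum fun a _ => ?_
    rw [Pi.mul_apply, ← sq, sq_abs, mul_comm]
    exact mul_le_mul_of_nonneg_right
      (pow_le_pow_of_le_one (M.p_nonneg a) (M.p_le_one a) hc) (sq_nonneg _)

variable {t n : ℕ}

lemma phi_starEdges (M : SBM) (hM : M.Q.IsDiag) (φ : Fin (t + 1) ↪ Fin n) :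
    M.phi (starEdges φ) = M.diagMoment (t + 1) t := by
  unfold phi
  simp_rw [M.prod_starEdges_edgeWeight hM φ]
  rw [M.labelMean_monoOn]
  simp [diagMoment, mul_comm]

lemma phi_symmDiff_of_disjoint (M : SBM) {S T : Finset (Sym2 (Fin n))} (h : Disjoint S T) :
    M.phi (symmDiff S T) =
      M.labelMean fun x => (∏ e ∈ S, M.edgeWeight x e) * ∏ e ∈ T, M.edgeWeight x e := by
  unfold phi
  simp_rw [← Finset.prod_union h]
  rw [h.symmDiff_eq_sup]
  rfl

lemma disjoint_starEdges {φ ψ : Fin (t + 1) ↪ Fin n}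
    (h : (Finset.univ.map φ ∩ Finset.univ.map ψ).card ≤ 1) :
    Disjoint (starEdges φ) (starEdges ψ) := by
  rw [Finset.disjoint_left]
  intro e h1 h2
  have hsub : ∀ {χ : Fin (t + 1) ↪ Fin n}, e ∈ starEdges χ → e.toFinset ⊆ Finset.univ.map χ := by
    intro χ hχ i hi
    obtain ⟨j, rfl⟩ := mem_starEdges.1 hχ
    rcases Sym2.mem_iff.1 (Sym2.mem_toFinset.1 hi) with rfl | rfl <;> simp
  have hc := Finset.card_le_card (Finset.subset_inter (hsub h1) (hsub h2))
  rw [Sym2.card_toFinset_of_not_isDiag e (mem_pairSet.1 (starEdges_subset φ h1))] at hc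
  omega

lemma phi_symmDiff_star_of_disjoint (M : SBM) (hM : M.Q.IsDiag) {φ ψ : Fin (t + 1) ↪ Fin n}
    (h : Disjoint (Finset.univ.map φ) (Finset.univ.map ψ)) :
    M.phi (symmDiff (starEdges φ) (starEdges ψ)) = M.diagMoment (t + 1) t ^ 2 := by
  rw [phi_symmDiff_of_disjoint _ (disjoint_starEdges (by
    rw [Finset.disjoint_iff_inter_eq_empty.1 h]; simp))]
  simp_rw [M.prod_starEdges_edgeWeight hM]
  rw [M.labelMean_monoOn_mul _ _ h]
  simp [diagMoment, mul_comm, sq]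

/-- Stars meeting in one vertex share no edge, and together they form a connected graph with `2t +
1` vertices and `2t` edges. -/
lemma phi_symmDiff_star_of_card_inter (M : SBM) (hM : M.Q.IsDiag) {φ ψ : Fin (t + 1) ↪ Fin n}
    (h : (Finset.univ.map φ ∩ Finset.univ.map ψ).card = 1) :
    M.phi (symmDiff (starEdges φ) (starEdges ψ)) = M.diagMoment (2 * t + 1) (2 * t) := by
  have hnd : ¬ Disjoint (Finset.univ.map φ) (Finset.univ.map ψ) := by
    rw [Finset.disjoint_iff_inter_eq_empty]
    intro h0
    simp [h0] at h
  have hc := Finset.card_union_add_card_inter (Finset.univ.map φ) (Finset.univ.map ψ)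
  rw [h] at hc
  simp only [Finset.card_map, Finset.card_univ, Fintype.card_fin] at hc
  rw [phi_symmDiff_of_disjoint _ (disjoint_starEdges h.le)]
  simp_rw [M.prod_starEdges_edgeWeight hM, M.monoOn_mul _ _ hnd]
  rw [M.labelMean_monoOn, show (Finset.univ.map φ ∪ Finset.univ.map ψ).card = 2 * t + 1 by omega]
  refine Finset.sum_congr rfl fun a _ => ?_
  rw [Pi.mul_apply]
  ring

/-- Each star has an edge outside the other. All other weights in the symmetric difference are at
most `1` in absolute value, so only this pair of distinct edges needs to be kept. -/
lemma phi_symmDiff_star_le (M : SBM) (hM : M.Q.IsDiag) {φ ψ : Fin (t + 1) ↪ Fin n}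
    (h : starEdges φ ≠ starEdges ψ) :
    M.phi (symmDiff (starEdges φ) (starEdges ψ)) ≤ M.diagMoment 3 2 := by
  have hex : ∀ {S T : Finset (Sym2 (Fin n))}, S ≠ T → S.card = T.card → ∃ e ∈ S, e ∉ T := by
    intro S T hne hc
    by_contra hcon
    push Not at hcon
    exact hne (Finset.eq_of_subset_of_card_le hcon hc.ge)
  have hc : (starEdges φ).card = (starEdges ψ).card := by
    rw [card_starEdges, card_starEdges]
  obtain ⟨e, he, he'⟩ := hex h hc
  obtain ⟨f, hf, hf'⟩ := hex h.symm hc.symm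
  have hef : e ≠ f := by rintro rfl; exact he' hf
  refine (M.labelMean_mono fun x => ?_).trans (M.labelMean_abs_mul_abs_le hM
    (starEdges_subset φ he) (starEdges_subset ψ hf) hef)
  have hsub : {e, f} ⊆ symmDiff (starEdges φ) (starEdges ψ) := by
    intro g hg
    rcases Finset.mem_insert.1 hg with rfl | hg
    · exact Finset.mem_symmDiff.2 (Or.inl ⟨he, he'⟩)
    · rw [Finset.mem_singleton.1 hg]
      exact Finset.mem_symmDiff.2 (Or.inr ⟨hf, hf'⟩)
  refine (le_abs_self _).trans ?_
  rw [Finset.abs_prod, ← Finset.prod_sdiff hsub, Finset.prod_pair hef]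
  exact mul_le_of_le_one_left (mul_nonneg (abs_nonneg _) (abs_nonneg _))
    (Finset.prod_le_one (fun _ _ => abs_nonneg _) fun g _ => M.abs_edgeWeight_le x g)

end SBM

/-! ### Variances of labelled star counts. -/

/-- There are at most `u ^ |α| * n ^ u` maps `α → Fin n` with an image of size `u`. -/
lemma card_image_eq_le {α : Type*} [Fintype α] [DecidableEq α] (n u : ℕ) :
    (Finset.univ.filter fun z : α → Fin n => (Finset.univ.image z).card = u).card ≤
      u ^ Fintype.card α * n ^ u := by
  -- Such a map factors through an enumeration of its image by `Fin u`.
  have hsub : (Finset.univ.filter fun z : α → Fin n => (Finset.univ.image z).card = u) ⊆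
      Finset.univ.image fun q : (α → Fin u) × (Fin u → Fin n) => q.2 ∘ q.1 := by
    intro z hz
    let e := Finset.equivFinOfCardEq (Finset.mem_filter.1 hz).2
    refine Finset.mem_image.2 ⟨(fun a => e ⟨z a, by simp⟩, fun i => e.symm i),
      Finset.mem_univ _, ?_⟩
    funext a
    simp
  refine (Finset.card_le_card hsub).trans (Finset.card_image_le.trans ?_)
  simp

lemma card_embedding_pairs_le (m n u : ℕ) :
    (Finset.univ.filter fun q : (Fin m ↪ Fin n) × (Fin m ↪ Fin n) =>
      (Finset.univ.map q.1 ∪ Finset.univ.map q.2).card = u).card ≤ u ^ (2 * m) * n ^ u := by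
  have h := card_image_eq_le (α := Fin m ⊕ Fin m) n u
  rw [Fintype.card_sum, Fintype.card_fin, ← two_mul] at h
  refine (Finset.card_le_card_of_injOn (fun q => Sum.elim q.1 q.2) ?_ ?_).trans h
  · intro q hq
    have hq' := (Finset.mem_filter.1 hq).2
    refine Finset.mem_coe.2 (Finset.mem_filter.2 ⟨Finset.mem_univ _, ?_⟩)
    rw [← hq']
    congr 1
    ext i
    simp
  · rintro ⟨φ, ψ⟩ - ⟨φ', ψ'⟩ - heq
    have h1 : ∀ i, φ i = φ' i := fun i => congrFun heq (Sum.inl i)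
    have h2 : ∀ i, ψ i = ψ' i := fun i => congrFun heq (Sum.inr i)
    exact Prod.ext (DFunLike.ext _ _ h1) (DFunLike.ext _ _ h2)

namespace SBM

variable {n : ℕ}

lemma expect_starSum (M : SBM) (hM : M.Q.IsDiag) (t : ℕ) :
    M.expect (starSum t (n := n)) = n.descFactorial (t + 1) * M.diagMoment (t + 1) t := by
  unfold starSum
  rw [M.expect_sum, Finset.sum_congr rfl fun φ _ => (M.expect_character
    (starEdges_subset φ)).trans (M.phi_starEdges hM φ), Finset.sum_const, Finset.card_univ,
    Fintype.card_embedding_eq, nsmul_eq_mul, Fintype.card_fin, Fintype.card_fin]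

/-- A variance bound from a bound on the covariances in terms of the size of the union. -/
lemma variance_starSum_le_sum (M : SBM) (hM : M.Q.IsDiag) (t : ℕ) (β : ℕ → ℝ)
    (hβ : ∀ φ ψ : Fin (t + 1) ↪ Fin n, M.phi (symmDiff (starEdges φ) (starEdges ψ)) -
      M.diagMoment (t + 1) t ^ 2 ≤ β (Finset.univ.map φ ∪ Finset.univ.map ψ).card)
    (hβ0 : ∀ u, 0 ≤ β u) :
    Var[starSum t (n := n); M.law n] ≤
      (2 * t + 2) ^ (2 * (t + 1)) * ∑ u ∈ Finset.Icc (t + 1) (2 * t + 2), n ^ u * β u := by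
  have hV : Var[starSum t (n := n); M.law n] =
      ∑ q : (Fin (t + 1) ↪ Fin n) × (Fin (t + 1) ↪ Fin n),
        (M.phi (symmDiff (starEdges q.1) (starEdges q.2)) - M.diagMoment (t + 1) t ^ 2) := by
    rw [M.variance_law, M.expect_starSum hM, Finset.sum_sub_distrib]
    congr 1
    · have h : (fun G : SimpleGraph (Fin n) => starSum t G * starSum t G) = fun G =>
          ∑ q : (Fin (t + 1) ↪ Fin n) × (Fin (t + 1) ↪ Fin n),
            character (symmDiff (starEdges q.1) (starEdges q.2)) G := by
        funext G
        unfold starSum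
        rw [Finset.sum_mul_sum, Fintype.sum_prod_type]
        refine Finset.sum_congr rfl fun φ _ => Finset.sum_congr rfl fun ψ _ => ?_
        exact character_mul _ _ _
      rw [h, M.expect_sum]
      exact Finset.sum_congr rfl fun q _ => M.expect_character
        (symmDiff_subset_pairSet (starEdges_subset q.1) (starEdges_subset q.2))
    · rw [Finset.sum_const, nsmul_eq_mul, Finset.card_univ, Fintype.card_prod,
        Fintype.card_embedding_eq, Fintype.card_fin, Fintype.card_fin]
      push_cast
      ring
  rw [hV]
  calc _ ≤ ∑ q : (Fin (t + 1) ↪ Fin n) × (Fin (t + 1) ↪ Fin n),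
        β (Finset.univ.map q.1 ∪ Finset.univ.map q.2).card :=
        Finset.sum_le_sum fun q _ => hβ q.1 q.2
    _ = ∑ u ∈ Finset.Icc (t + 1) (2 * t + 2),
        ∑ q : (Fin (t + 1) ↪ Fin n) × (Fin (t + 1) ↪ Fin n) with
          (Finset.univ.map q.1 ∪ Finset.univ.map q.2).card = u,
          β (Finset.univ.map q.1 ∪ Finset.univ.map q.2).card := by
        rw [Finset.sum_fiberwise_of_maps_to]
        intro q _
        have h1 := Finset.card_le_card
          (Finset.subset_union_left (s₁ := Finset.univ.map q.1) (s₂ := Finset.univ.map q.2))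
        have h2 := Finset.card_union_le (Finset.univ.map q.1) (Finset.univ.map q.2)
        simp only [Finset.card_map, Finset.card_univ, Fintype.card_fin] at h1 h2
        rw [Finset.mem_Icc]
        omega
    _ ≤ ∑ u ∈ Finset.Icc (t + 1) (2 * t + 2), (2 * t + 2) ^ (2 * (t + 1)) * (n ^ u * β u) := by
        refine Finset.sum_le_sum fun u hu => ?_
        rw [Finset.sum_congr rfl (g := fun _ => β u) fun q hq => by
          rw [(Finset.mem_filter.1 hq).2], Finset.sum_const, nsmul_eq_mul, ← mul_assoc]
        refine mul_le_mul_of_nonneg_right ?_ (hβ0 u)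
        have h1 : u ^ (2 * (t + 1)) * n ^ u ≤ (2 * t + 2) ^ (2 * (t + 1)) * n ^ u :=
          Nat.mul_le_mul_right _ (Nat.pow_le_pow_left (Finset.mem_Icc.1 hu).2 _)
        exact_mod_cast (card_embedding_pairs_le (t + 1) n u).trans h1
    _ = _ := by rw [Finset.mul_sum]

/-- A bound for the covariance of two labelled stars with `t` edges covering `u` vertices. -/
noncomputable def covBound (M : SBM) (t u : ℕ) : ℝ :=
  -- The cases are disjoint stars, one common vertex, larger overlap with distinct vertex sets, and
  -- equal vertex sets. For `t = 1` the second value coincides with the third.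
  if u = 2 * t + 2 then 0
  else if u = 2 * t + 1 ∧ t ≠ 1 then M.diagMoment (2 * t + 1) (2 * t)
  else if t + 1 < u then M.diagMoment 3 2
  else 1

lemma covBound_nonneg (M : SBM) (t u : ℕ) : 0 ≤ M.covBound t u := by
  unfold covBound
  split_ifs
  exacts [le_rfl, M.diagMoment_nonneg _ (even_two_mul t), M.diagMoment_nonneg _ even_two,
    zero_le_one]

lemma cov_star_le (M : SBM) (hM : M.Q.IsDiag) {t : ℕ} (φ ψ : Fin (t + 1) ↪ Fin n) :
    M.phi (symmDiff (starEdges φ) (starEdges ψ)) - M.diagMoment (t + 1) t ^ 2 ≤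
      M.covBound t (Finset.univ.map φ ∪ Finset.univ.map ψ).card := by
  have hc := Finset.card_union_add_card_inter (Finset.univ.map φ) (Finset.univ.map ψ)
  simp only [Finset.card_map, Finset.card_univ, Fintype.card_fin] at hc
  have hsq := sq_nonneg (M.diagMoment (t + 1) t)
  unfold covBound
  split_ifs with h1 h2 h3
  · rw [M.phi_symmDiff_star_of_disjoint hM, sub_self]
    rw [Finset.disjoint_iff_inter_eq_empty, ← Finset.card_eq_zero]
    omega
  · rw [M.phi_symmDiff_star_of_card_inter hM (by omega)]
    linarith
  -- Equal edge sets would give equal vertex sets, contradicting a union of more than `t + 1`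
  -- vertices.
  · by_cases heq : starEdges φ = starEdges ψ
    · exfalso
      have ht : 0 < t := by
        by_contra h0
        have := Finset.card_union_le (Finset.univ.map φ) (Finset.univ.map ψ)
        simp only [Finset.card_map, Finset.card_univ, Fintype.card_fin] at this
        omega
      have hV : ∀ χ : Fin (t + 1) ↪ Fin n, Finset.univ.map χ =
          (starEdges χ).biUnion Sym2.toFinset := by
        intro χ
        ext i
        simp only [Finset.mem_map, Finset.mem_univ, true_and, Finset.mem_biUnion,
          Sym2.mem_toFinset]
        constructor
        · rintro ⟨j, rfl⟩
          by_cases hj : j = 0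
          · subst hj
            exact ⟨s(χ 0, χ (Fin.succ ⟨0, ht⟩)), mem_starEdges.2 ⟨_, rfl⟩, by simp⟩
          · obtain ⟨j, rfl⟩ := Fin.exists_succ_eq.2 hj
            exact ⟨s(χ 0, χ j.succ), mem_starEdges.2 ⟨_, rfl⟩, by simp⟩
        · rintro ⟨e, he, hi⟩
          obtain ⟨j, rfl⟩ := mem_starEdges.1 he
          rcases Sym2.mem_iff.1 hi with rfl | rfl
          exacts [⟨_, rfl⟩, ⟨_, rfl⟩]
      have hUV : Finset.univ.map φ = Finset.univ.map ψ := by rw [hV, hV, heq]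
      rw [hUV, Finset.union_self] at h3
      simp at h3
    · have := M.phi_symmDiff_star_le hM heq
      linarith
  · have := M.phi_le_one (symmDiff (starEdges φ) (starEdges ψ))
    linarith

lemma variance_starSum_one_le (M : SBM) (hM : M.Q.IsDiag) :
    Var[starSum 1 (n := n); M.law n] ≤ 4 ^ 4 * (n ^ 2 + n ^ 3 * M.diagMoment 3 2) := by
  refine (M.variance_starSum_le_sum hM 1 _ (M.cov_star_le hM)
    (M.covBound_nonneg _)).trans (le_of_eq ?_)
  rw [show Finset.Icc (1 + 1) (2 * 1 + 2) = {2, 3, 4} by decide]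
  norm_num [covBound]

lemma variance_starSum_two_le (M : SBM) (hM : M.Q.IsDiag) :
    Var[starSum 2 (n := n); M.law n] ≤
      6 ^ 6 * (n ^ 3 + n ^ 4 * M.diagMoment 3 2 + n ^ 5 * M.diagMoment 5 4) := by
  refine (M.variance_starSum_le_sum hM 2 _ (M.cov_star_le hM)
    (M.covBound_nonneg _)).trans (le_of_eq ?_)
  rw [show Finset.Icc (2 + 1) (2 * 2 + 2) = {3, 4, 5, 6} by decide]
  norm_num [covBound]
  ring

/-- Each `p² q²` is at most `√w`, since its square is at most `p³ q²`, a single term of `w`. -/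
lemma diagMoment_five_four_le (M : SBM) :
    M.diagMoment 5 4 ≤ M.diagMoment 3 2 * √(M.diagMoment 3 2) := by
  unfold diagMoment
  rw [Finset.sum_mul]
  refine Finset.sum_le_sum fun a _ => ?_
  have h0 : 0 ≤ M.p a ^ 3 * M.Q a a ^ 2 :=
    mul_nonneg (pow_nonneg (M.p_nonneg a) _) (sq_nonneg _)
  calc M.p a ^ 5 * M.Q a a ^ 4 = M.p a ^ 3 * M.Q a a ^ 2 * (M.p a ^ 2 * M.Q a a ^ 2) := by ring
    _ ≤ _ := by
      refine mul_le_mul_of_nonneg_left (Real.le_sqrt_of_sq_le ?_) h0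
      have hq : M.Q a a ^ 2 ≤ 1 := (sq_le_one_iff_abs_le_one _).2 (M.Q_le a a)
      calc (M.p a ^ 2 * M.Q a a ^ 2) ^ 2 = M.p a ^ 3 * M.Q a a ^ 2 * (M.p a * M.Q a a ^ 2) := by
            ring
        _ ≤ M.p a ^ 3 * M.Q a a ^ 2 * 1 := mul_le_mul_of_nonneg_left
            (mul_le_one₀ (M.p_le_one a) (sq_nonneg _) hq) h0
        _ ≤ ∑ a, M.p a ^ 3 * M.Q a a ^ 2 := by
            rw [mul_one]
            exact Finset.single_le_sum (f := fun a => M.p a ^ 3 * M.Q a a ^ 2)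
              (fun a _ => mul_nonneg (pow_nonneg (M.p_nonneg a) _) (sq_nonneg _))
              (Finset.mem_univ a)

end SBM

/-! ### From a successful test to a large moment, and from a large moment to a gap. -/

lemma trivialSBM_isDiag : trivialSBM.Q.IsDiag := fun _ _ _ => rfl

lemma trivialSBM_diagMoment (v : ℕ) {j : ℕ} (hj : j ≠ 0) : trivialSBM.diagMoment v j = 0 := by
  simp [SBM.diagMoment, trivialSBM, hj]

/-- If a constant-degree test distinguishes, then the edge or the wedge moment is large. -/
lemma Distinguishes.eventually_moment_large {M : ℕ → SBM} (hM : ∀ n, (M n).Q.IsDiag) {D : ℕ}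
    {f : (n : ℕ) → SimpleGraph (Fin n) → ℝ} (hf : ∀ n, IsPolyDegreeLE D (f n))
    (h : Distinguishes M f) {B : ℝ} (hB : 1 ≤ B) :
    ∀ᶠ n : ℕ in atTop, B < n * |(M n).diagMoment 2 1| ∨ B < n * √n * (M n).diagMoment 3 2 := by
  set K : ℝ := 2 ^ (2 * D + 1).choose 2 * ∑ u ∈ Finset.range (2 * D + 1), (B ^ 2) ^ u with hK
  have hK0 : 0 ≤ K := by positivity
  filter_upwards [h (K + 1) (by linarith), eventually_ge_atTop 1] with n hn hn1
  by_contra! hcon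
  obtain ⟨he, hw⟩ := hcon
  have hn0 : (0 : ℝ) < n := by exact_mod_cast hn1
  have hs0 : 0 < √(n : ℝ) := Real.sqrt_pos.2 hn0
  have hs2 : √(n : ℝ) ^ 2 = n := Real.sq_sqrt hn0.le
  have hB0 : 0 < B := by linarith
  -- With `r = B / √n` the quantity `n r²` is the constant `B²`; the moment hypotheses hold because
  -- `B ≤ B²` and `B ≤ B³`.
  have hphi := (M n).sum_sq_phi_le (hM n) (n := n) (D := D) (r := B / √n) (by positivity)
    (by
      rw [div_pow, hs2, le_div_iff₀ hn0]
      nlinarith)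
    (by
      rw [div_pow, le_div_iff₀ (by positivity), pow_succ, hs2]
      calc (M n).diagMoment 3 2 * (n * √n) = n * √n * (M n).diagMoment 3 2 := by ring
        _ ≤ B := hw
        _ ≤ B ^ 3 := le_self_pow₀ hB (by norm_num))
  have hr : (n : ℝ) * (B / √n) ^ 2 = B ^ 2 := by
    rw [div_pow, hs2]; field_simp
  rw [hr, ← hK] at hphi
  have herase : ∑ S ∈ (lowSets n D).erase ∅, (M n).phi S ^ 2 ≤ K :=
    (Finset.sum_le_sum_of_subset_of_nonneg (Finset.erase_subset _ _)
      fun _ _ _ => sq_nonneg _).trans hphi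
  have hlow := sq_expect_sub_le (M n) (hf n)
  rw [nullLaw_eq, SBM.integral_law, SBM.integral_law] at hn
  have hV0 := variance_nonneg (f n) (trivialSBM.law n)
  have hV1 := variance_nonneg (f n) ((M n).law n)
  have h1 := pow_lt_pow_left₀ hn (by positivity) two_ne_zero
  rw [mul_pow, Real.sq_sqrt (by linarith), sq_abs] at h1
  have h2 : Var[f n; trivialSBM.law n] * ∑ S ∈ (lowSets n D).erase ∅, (M n).phi S ^ 2 ≤
      Var[f n; trivialSBM.law n] * K := mul_le_mul_of_nonneg_left herase hV0
  have h3 : Var[f n; trivialSBM.law n] * K ≤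
      (K + 1) ^ 2 * (Var[f n; trivialSBM.law n] + Var[f n; (M n).law n]) := by
    have : K ≤ (K + 1) ^ 2 := by nlinarith
    calc _ ≤ Var[f n; trivialSBM.law n] * (K + 1) ^ 2 := mul_le_mul_of_nonneg_left this hV0
      _ ≤ _ := by
        rw [mul_comm]
        exact mul_le_mul_of_nonneg_left (by linarith) (by positivity)
  linarith

/-- The gap of the edge count in a single model. -/
lemma starSum_one_gap (M : SBM) (hM : M.Q.IsDiag) {n : ℕ} (hn : 4 ≤ n) {C : ℝ}
    (hwe : M.diagMoment 3 2 ≤ |M.diagMoment 2 1|) (h1 : 1 ≤ n * |M.diagMoment 2 1|)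
    (hC : 12288 * C ^ 2 < n * |M.diagMoment 2 1|) :
    C ^ 2 * (Var[starSum 1; trivialSBM.law n] + Var[starSum 1; M.law n]) <
      M.expect (starSum 1 (n := n)) ^ 2 := by
  have hV0 := trivialSBM.variance_starSum_one_le trivialSBM_isDiag (n := n)
  rw [trivialSBM_diagMoment _ two_ne_zero] at hV0
  have hV1 := M.variance_starSum_one_le hM (n := n)
  rw [M.expect_starSum hM]
  norm_num only at hV0 hV1 ⊢
  set e := |M.diagMoment 2 1| with he
  set w := M.diagMoment 3 2
  have hn0 : (4 : ℝ) ≤ n := by exact_mod_cast hn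
  have hdesc : (n : ℝ) ^ 2 / 4 ≤ n.descFactorial 2 := by
    have h := Nat.pow_sub_le_descFactorial n 2
    have h' : (((n + 1 - 2 : ℕ) : ℝ)) ^ 2 ≤ n.descFactorial 2 := by exact_mod_cast h
    rw [Nat.cast_sub (by omega)] at h'
    push_cast at h'
    nlinarith
  -- `768 = 3 · 4⁴`: one term from the null model, two from the block model. With the factor `1 /
  -- 16` from squaring `n² / 4` this gives `12288`.
  have hV : Var[starSum 1; trivialSBM.law n] + Var[starSum 1; M.law n] ≤
      768 * n ^ 2 * (n * e) := by
    have h3 : (n : ℝ) ^ 3 * w ≤ n ^ 2 * (n * e) := by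
      calc (n : ℝ) ^ 3 * w ≤ n ^ 3 * e := by gcongr
        _ = _ := by ring
    have h4 : (n : ℝ) ^ 2 ≤ n ^ 2 * (n * e) := le_mul_of_one_le_right (by positivity) h1
    linarith
  calc C ^ 2 * (Var[starSum 1; trivialSBM.law n] + Var[starSum 1; M.law n]) ≤
        C ^ 2 * (768 * n ^ 2 * (n * e)) := mul_le_mul_of_nonneg_left hV (sq_nonneg C)
    _ = (12288 * C ^ 2) * (n ^ 2 / 16 * (n * e)) := by ring
    _ < (n * e) * (n ^ 2 / 16 * (n * e)) := by
      refine mul_lt_mul_of_pos_right hC ?_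
      have : 0 < (n : ℝ) := by linarith
      have : 0 < (n : ℝ) * e := by linarith
      positivity
    _ = (n ^ 2 / 4 * e) ^ 2 := by ring
    _ ≤ (n.descFactorial 2 * e) ^ 2 := by
      gcongr
    _ = _ := by rw [mul_pow, he, sq_abs, ← mul_pow]

/-- The gap of the wedge count in a single model. -/
lemma starSum_two_gap (M : SBM) (hM : M.Q.IsDiag) {n : ℕ} (hn : 4 ≤ n) {C : ℝ}
    (h1 : 1 ≤ n * √n * M.diagMoment 3 2)
    (hC : (256 * 6 ^ 6 * C ^ 2) ^ 2 < n * √n * M.diagMoment 3 2) :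
    C ^ 2 * (Var[starSum 2; trivialSBM.law n] + Var[starSum 2; M.law n]) <
      M.expect (starSum 2 (n := n)) ^ 2 := by
  have hV0 := trivialSBM.variance_starSum_two_le trivialSBM_isDiag (n := n)
  rw [trivialSBM_diagMoment _ two_ne_zero, trivialSBM_diagMoment _ four_ne_zero] at hV0
  have hV1 := M.variance_starSum_two_le hM (n := n)
  have hs := M.diagMoment_five_four_le
  have hw0 := M.diagMoment_nonneg 3 even_two
  rw [M.expect_starSum hM]
  simp only [Nat.reduceAdd]
  set w := M.diagMoment 3 2
  set s := M.diagMoment 5 4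
  have hn0 : (4 : ℝ) ≤ n := by exact_mod_cast hn
  have hdesc : (n : ℝ) ^ 3 / 8 ≤ n.descFactorial 3 := by
    have h := Nat.pow_sub_le_descFactorial n 3
    have h' : (((n + 1 - 3 : ℕ) : ℝ)) ^ 3 ≤ n.descFactorial 3 := by exact_mod_cast h
    rw [Nat.cast_sub (by omega)] at h'
    push_cast at h'
    refine le_trans ?_ h'
    calc (n : ℝ) ^ 3 / 8 = (n / 2) ^ 3 := by ring
      _ ≤ _ := pow_le_pow_left₀ (by positivity) (by linarith) 3
  -- Writing `n = y²` clears the half-integer powers of `n`.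
  obtain ⟨y, hy⟩ : ∃ y, y = √(n : ℝ) := ⟨_, rfl⟩
  have hyn : (n : ℝ) = y ^ 2 := by rw [hy, Real.sq_sqrt (by linarith)]
  have hy1 : 1 ≤ y := by rw [hy, Real.one_le_sqrt]; linarith
  have hy0 : 0 ≤ y := by linarith
  rw [← hy, hyn] at h1 hC
  rw [hyn] at hV0 hV1 hdesc
  set W := y ^ 2 * y * w with hW
  have hW1 : 1 ≤ √W := Real.one_le_sqrt.2 h1
  have hWW : √W * √W = W := Real.mul_self_sqrt (by linarith)
  -- Four terms, one null and three planted. The factor `4 · 6⁶` times the `64` from squaring `n³ /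
  -- 8` is `256 · 6⁶`; it is compared with `√W`, which is why its square appears in `hC`.
  have hV : Var[starSum 2; trivialSBM.law n] + Var[starSum 2; M.law n] ≤
      6 ^ 6 * 4 * (y ^ 6 * (W * √W)) := by
    have hy6 : 0 ≤ y ^ 6 := by positivity
    have hWs : W ≤ W * √W := le_mul_of_one_le_right (by linarith) hW1
    have a1 : (y ^ 2) ^ 3 ≤ y ^ 6 * (W * √W) := by
      rw [← pow_mul]
      exact le_mul_of_one_le_right hy6 (h1.trans hWs)
    have a2 : (y ^ 2) ^ 4 * w ≤ y ^ 6 * (W * √W) := by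
      calc (y ^ 2) ^ 4 * w = y ^ 5 * W := by rw [hW]; ring
        _ ≤ y ^ 6 * W := by
          refine mul_le_mul_of_nonneg_right ?_ (by linarith)
          exact pow_le_pow_right₀ hy1 (by norm_num)
        _ ≤ _ := mul_le_mul_of_nonneg_left hWs hy6
    have a3 : (y ^ 2) ^ 5 * s ≤ y ^ 6 * (W * √W) := by
      have hys : y * √w ≤ √W := by
        refine Real.le_sqrt_of_sq_le ?_
        rw [mul_pow, Real.sq_sqrt hw0, hW]
        refine mul_le_mul_of_nonneg_right ?_ hw0
        exact le_mul_of_one_le_right (by positivity) hy1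
      calc (y ^ 2) ^ 5 * s ≤ (y ^ 2) ^ 5 * (w * √w) := by gcongr
        _ = y ^ 6 * (W * (y * √w)) := by rw [hW]; ring
        _ ≤ _ := by
          refine mul_le_mul_of_nonneg_left (mul_le_mul_of_nonneg_left hys ?_) hy6
          linarith
    simp only [mul_zero, add_zero] at hV0
    linarith
  have hC' : 256 * 6 ^ 6 * C ^ 2 < √W := Real.lt_sqrt_of_sq_lt hC
  calc C ^ 2 * (Var[starSum 2; trivialSBM.law n] + Var[starSum 2; M.law n]) ≤
        C ^ 2 * (6 ^ 6 * 4 * (y ^ 6 * (W * √W))) := mul_le_mul_of_nonneg_left hV (sq_nonneg C)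
    _ = (256 * 6 ^ 6 * C ^ 2) * (y ^ 6 / 64 * (W * √W)) := by ring
    _ < √W * (y ^ 6 / 64 * (W * √W)) := by
      refine mul_lt_mul_of_pos_right hC' ?_
      have : 0 < y := by linarith
      have : 0 < W := by linarith
      have : 0 < √W := by linarith
      positivity
    _ = y ^ 6 / 64 * W * (√W * √W) := by ring
    _ = ((y ^ 2) ^ 3 / 8 * w) ^ 2 := by rw [hWW, hW]; ring
    _ ≤ (n.descFactorial 3 * w) ^ 2 := by gcongr

/-- The gap condition for labelled stars is the gap condition for signed star counts. -/
lemma signedCount_gap {M : SBM} {n t : ℕ} (ht : t ≠ 0) {C : ℝ}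
    (h : C ^ 2 * (Var[starSum t; trivialSBM.law n] + Var[starSum t; M.law n]) <
      M.expect (starSum t (n := n)) ^ 2) :
    C * √(Var[signedCount (starWithEdges t); nullLaw n] +
        Var[signedCount (starWithEdges t); M.law n]) <
      |(∫ G, signedCount (starWithEdges t) G ∂(nullLaw n)) -
        ∫ G, signedCount (starWithEdges t) G ∂(M.law n)| := by
  have hκ : (0 : ℝ) < starAut t := by exact_mod_cast starAut_pos t
  have hfun : (starSum t : SimpleGraph (Fin n) → ℝ) =
      fun G => starAut t * signedCount (starWithEdges t) G := funext fun G => starSum_eq t G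
  have h0 := trivialSBM.expect_starSum trivialSBM_isDiag t (n := n)
  rw [trivialSBM_diagMoment _ ht, mul_zero] at h0
  rw [hfun, variance_const_mul, variance_const_mul, SBM.expect_const_mul, mul_pow, ← mul_add,
    mul_left_comm] at h
  rw [hfun, SBM.expect_const_mul] at h0
  have h0' := (mul_eq_zero.1 h0).resolve_left hκ.ne'
  rw [nullLaw_eq, SBM.integral_law, SBM.integral_law]
  have hz : trivialSBM.expect (signedCount (starWithEdges t) (n := n)) = 0 := h0'
  rw [hz, zero_sub, abs_neg]
  have h2 := lt_of_mul_lt_mul_left h (sq_nonneg _)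
  refine abs_lt_of_sq_lt_sq' ?_ (abs_nonneg _) |>.2
  rw [mul_pow, Real.sq_sqrt (add_nonneg (variance_nonneg _ _) (variance_nonneg _ _)), sq_abs]
  exact h2

lemma integral_signedCount_nullLaw {n t : ℕ} (ht : t ≠ 0) :
    ∫ G, signedCount (starWithEdges t) G ∂(nullLaw n) = 0 := by
  have hκ : (0 : ℝ) < starAut t := by exact_mod_cast starAut_pos t
  have h0 := trivialSBM.expect_starSum trivialSBM_isDiag t (n := n)
  have hfun : (starSum t : SimpleGraph (Fin n) → ℝ) =
      fun G => starAut t * signedCount (starWithEdges t) G := funext fun G => starSum_eq t G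
  rw [trivialSBM_diagMoment _ ht, mul_zero, hfun, SBM.expect_const_mul] at h0
  rw [nullLaw_eq, SBM.integral_law]
  exact (mul_eq_zero.1 h0).resolve_left hκ.ne'

/-! ### Thresholds from Chebyshev's inequality. -/

lemma tendsto_zero_of_le_div_sq {P : ℕ → ℝ} (h0 : ∀ n, 0 ≤ P n)
    (h : ∀ C : ℝ, 0 < C → ∀ᶠ n in atTop, P n ≤ 4 / C ^ 2) : Tendsto P atTop (𝓝 0) := by
  refine tendsto_order.2 ⟨fun a ha => Eventually.of_forall fun n => ha.trans_le (h0 n),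
    fun ε hε => ?_⟩
  -- This choice makes the bound `4 / C²` equal to `ε / 2`.
  filter_upwards [h (√(8 / ε)) (by positivity)] with n hn
  rw [Real.sq_sqrt (by positivity), div_div_eq_mul_div] at hn
  linarith

lemma measureReal_le_variance_div_sq {Ω : Type*} [MeasurableSpace Ω] {μ : Measure Ω}
    [IsFiniteMeasure μ] {X : Ω → ℝ} (hX : MemLp X 2 μ) {c : ℝ} (hc : 0 < c) {s : Set Ω}
    (hs : s ⊆ {ω | c ≤ |X ω - μ[X]|}) : μ.real s ≤ Var[X; μ] / c ^ 2 :=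
  ENNReal.toReal_le_of_le_ofReal (div_nonneg (variance_nonneg _ _) (sq_nonneg _))
    ((measure_mono hs).trans (meas_ge_le_variance_div_sq hX hc))

/-- A distinguishing sequence of statistics centred under the null law gives a consistent test. -/
lemma Distinguishes.exists_threshold {M : ℕ → SBM} {f : (n : ℕ) → SimpleGraph (Fin n) → ℝ}
    (h : Distinguishes M f) (h0 : ∀ n, ∫ G, f n G ∂(nullLaw n) = 0) :
    ∃ c : ℕ → ℝ,
      Tendsto (fun n => (nullLaw n).real {G | c n ≤ |f n G|}) atTop (𝓝 0) ∧
      Tendsto (fun n => ((M n).law n).real {G | |f n G| < c n}) atTop (𝓝 0) := by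
  -- The threshold is half the absolute planted mean: the null mean is `0`, so either error requires
  -- a deviation of at least that size from the mean.
  have key : ∀ C : ℝ, 0 < C → ∀ᶠ n in atTop, 0 < |∫ G, f n G ∂((M n).law n)| / 2 ∧
      (Var[f n; nullLaw n] + Var[f n; (M n).law n]) /
        (|∫ G, f n G ∂((M n).law n)| / 2) ^ 2 ≤ 4 / C ^ 2 := by
    intro C hC
    filter_upwards [h C hC] with n hn
    rw [h0, zero_sub, abs_neg] at hn
    have hV0 := variance_nonneg (f n) (nullLaw n)
    have hV1 := variance_nonneg (f n) ((M n).law n)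
    have hpos : 0 < |∫ G, f n G ∂((M n).law n)| := lt_of_le_of_lt (by positivity) hn
    refine ⟨by linarith, ?_⟩
    have h1 := pow_lt_pow_left₀ hn (by positivity) two_ne_zero
    rw [mul_pow, Real.sq_sqrt (by linarith)] at h1
    rw [div_le_div_iff₀ (by positivity) (by positivity)]
    nlinarith
  refine ⟨fun n => |∫ G, f n G ∂((M n).law n)| / 2,
    tendsto_zero_of_le_div_sq (fun _ => measureReal_nonneg) fun C hC => ?_,
    tendsto_zero_of_le_div_sq (fun _ => measureReal_nonneg) fun C hC => ?_⟩
  · filter_upwards [key C hC] with n hn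
    have hX : MemLp (f n) 2 (nullLaw n) := by
      rw [nullLaw_eq]; exact trivialSBM.memLp_law _
    have : IsFiniteMeasure (nullLaw n) := by rw [nullLaw_eq]; infer_instance
    refine (measureReal_le_variance_div_sq hX hn.1 ?_).trans (le_trans ?_ hn.2)
    · intro G hG
      simpa [h0] using hG
    · gcongr
      have := variance_nonneg (f n) ((M n).law n)
      linarith
  · filter_upwards [key C hC] with n hn
    refine (measureReal_le_variance_div_sq ((M n).memLp_law (f n)) hn.1 ?_).trans
      (le_trans ?_ hn.2)
    · intro G hG
      have hG' : |f n G| < |∫ G, f n G ∂((M n).law n)| / 2 := hG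
      change _ ≤ |f n G - ∫ G, f n G ∂((M n).law n)|
      have h1 := abs_sub_abs_le_abs_sub (∫ G, f n G ∂((M n).law n)) (f n G)
      rw [abs_sub_comm] at h1
      linarith
    · gcongr
      have := variance_nonneg (f n) (nullLaw n)
      linarith

/-! ### Choosing between edge and wedge by the model alone. -/

open scoped Classical in
/-- The first index at which the model `M n` occurs. -/
noncomputable def firstIndex (M : ℕ → SBM) (n : ℕ) : ℕ :=
  Nat.find (⟨n, rfl⟩ : ∃ m, M m = M n)

lemma firstIndex_spec (M : ℕ → SBM) (n : ℕ) : M (firstIndex M n) = M n := by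
  classical
  exact Nat.find_spec (⟨n, rfl⟩ : ∃ m, M m = M n)

lemma firstIndex_le (M : ℕ → SBM) (n : ℕ) : firstIndex M n ≤ n := by
  classical
  exact Nat.find_min' _ rfl

lemma firstIndex_congr {M : ℕ → SBM} {m n : ℕ} (h : M m = M n) :
    firstIndex M m = firstIndex M n := by
  unfold firstIndex
  congr! 3

/-- The edge count is preferred to the wedge count for the model `M n`. -/
def PrefersEdge (M : ℕ → SBM) (n : ℕ) : Prop :=
  -- The `+ 1` keeps the factor at least `1` even at first index `0`, so preferring the edge always
  -- entails `w ≤ e`.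
  √((firstIndex M n : ℝ) + 1) * (M n).diagMoment 3 2 ≤ |(M n).diagMoment 2 1|

lemma prefersEdge_congr {M : ℕ → SBM} {m n : ℕ} (h : M m = M n) :
    PrefersEdge M m ↔ PrefersEdge M n := by
  unfold PrefersEdge
  rw [firstIndex_congr h, h]

open scoped Classical in
/-- The signal strength of the preferred count. -/
noncomputable def signal (M : ℕ → SBM) (n : ℕ) : ℝ :=
  if PrefersEdge M n then n * |(M n).diagMoment 2 1| else n * √n * (M n).diagMoment 3 2

/-- Models first occurring before `K` are finitely many; for each of them the preferred moment is
fixed and nonzero if the model recurs late, so its signal grows with `n`. For the others the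
hypothesis is applied at the first occurrence `m ≥ K`, where the preference rule compares the two
strengths, and the result passes to `n ≥ m` by monotonicity. -/
lemma eventually_lt_signal {M : ℕ → SBM}
    (hL : ∀ B : ℝ, 1 ≤ B → ∀ᶠ n : ℕ in atTop,
      B < n * |(M n).diagMoment 2 1| ∨ B < n * √n * (M n).diagMoment 3 2)
    {B : ℝ} (hB : 1 ≤ B) : ∀ᶠ n in atTop, B < signal M n := by
  -- The factor `2` pays for `√(m + 1) ≤ 2 √m` in the wedge case.
  obtain ⟨K, hK⟩ := eventually_atTop.1 (hL (2 * B) (by linarith))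
  have hsmall : ∀ᶠ n in atTop, ∀ m ∈ Finset.range K, M n = M m → B < signal M n := by
    rw [Filter.eventually_all_finset]
    intro m _
    have hw0 := (M m).diagMoment_nonneg 3 even_two
    have hsq : 0 < √((firstIndex M m : ℝ) + 1) := Real.sqrt_pos.2 (by positivity)
    have hlarge : ∀ x : ℝ, 0 < x → ∀ᶠ n : ℕ in atTop, B < n * x := fun x hx =>
      (tendsto_natCast_atTop_atTop.atTop_mul_const hx).eventually_gt_atTop B
    by_cases hp : PrefersEdge M m
    · rcases (abs_nonneg ((M m).diagMoment 2 1)).eq_or_lt with he | he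
      -- Here both moments vanish, which contradicts the hypothesis if the model recurs at an index
      -- beyond `K`.
      · filter_upwards [eventually_ge_atTop K] with n hn heq
        have hw : (M m).diagMoment 3 2 = 0 := by
          unfold PrefersEdge at hp
          rw [← he] at hp
          exact le_antisymm (nonpos_of_mul_nonpos_right hp hsq) hw0
        have := hK n hn
        rw [heq, ← he, hw] at this
        norm_num at this
        linarith
      · filter_upwards [hlarge _ he] with n hn heq
        rw [signal, if_pos ((prefersEdge_congr heq).2 hp), heq]
        exact hn
    · have hw : 0 < (M m).diagMoment 3 2 := by
        unfold PrefersEdge at hp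
        push Not at hp
        exact pos_of_mul_pos_right ((abs_nonneg _).trans_lt hp) hsq.le
      filter_upwards [hlarge _ hw, eventually_ge_atTop 1] with n hn hn1 heq
      rw [signal, if_neg (fun h => hp ((prefersEdge_congr heq).1 h)), heq]
      refine hn.trans_le (mul_le_mul_of_nonneg_right ?_ hw0)
      exact le_mul_of_one_le_right (Nat.cast_nonneg n)
        (Real.one_le_sqrt.2 (by exact_mod_cast hn1))
  filter_upwards [hsmall] with n hn
  rcases lt_or_ge (firstIndex M n) K with hlt | hge
  · exact hn _ (Finset.mem_range.2 hlt) (firstIndex_spec M n).symm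
  · have h := hK _ hge
    rw [firstIndex_spec M n] at h
    have hle : (firstIndex M n : ℝ) ≤ n := by exact_mod_cast firstIndex_le M n
    have hw0 := (M n).diagMoment_nonneg 3 even_two
    have he0 := abs_nonneg ((M n).diagMoment 2 1)
    unfold signal PrefersEdge
    set m : ℝ := (firstIndex M n : ℝ) with hm
    have hm0 : 0 ≤ m := Nat.cast_nonneg _
    set e := |(M n).diagMoment 2 1|
    set w := (M n).diagMoment 3 2
    split_ifs with hp
    · have h1 : m * e ≤ n * e := mul_le_mul_of_nonneg_right hle he0
      have h2 : m * √m * w ≤ m * e := by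
        rw [mul_assoc]
        refine mul_le_mul_of_nonneg_left (le_trans ?_ hp) hm0
        exact mul_le_mul_of_nonneg_right (Real.sqrt_le_sqrt (by linarith)) hw0
      rcases h with h | h <;> linarith
    · push Not at hp
      have h1 : m * √m * w ≤ n * √n * w := by gcongr
      rcases h with h | h
      · have hm1 : 1 ≤ m := by
          have : firstIndex M n ≠ 0 := by
            intro h0
            rw [hm, h0] at h
            norm_num at h
            linarith
          rw [hm]
          exact_mod_cast Nat.one_le_iff_ne_zero.2 this
        have h2 : √(m + 1) ≤ 2 * √m := by
          rw [Real.sqrt_le_left (by positivity), mul_pow, Real.sq_sqrt hm0]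
          linarith
        have h3 : m * e ≤ 2 * (m * √m * w) := by
          calc m * e ≤ m * (√(m + 1) * w) := mul_le_mul_of_nonneg_left hp.le hm0
            _ ≤ m * (2 * √m * w) := by gcongr
            _ = _ := by ring
        linarith
      · linarith

theorem mainTheorem7 (M : ℕ → SBM) (hdiag : ∀ n, (M n).Q.IsDiag)
    (htest : ∃ (D : ℕ) (f : (n : ℕ) → SimpleGraph (Fin n) → ℝ),
      (∀ n, IsPolyDegreeLE D (f n)) ∧ Distinguishes M f) :
    ∃ t : ℕ → ℕ, (∀ n, t n = 1 ∨ t n = 2) ∧ (∀ m n, M m = M n → t m = t n) ∧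
      Distinguishes M (fun n => signedCount (starWithEdges (t n))) ∧
      ∃ c : ℕ → ℝ,
        Tendsto (fun n => (nullLaw n).real {G | c n ≤ |signedCount (starWithEdges (t n)) G|})
          atTop (𝓝 0) ∧
        Tendsto (fun n => ((M n).law n).real {G | |signedCount (starWithEdges (t n)) G| < c n})
          atTop (𝓝 0) := by
  classical
  obtain ⟨D, f, hf, hdist⟩ := htest
  have hS : ∀ B : ℝ, 1 ≤ B → ∀ᶠ n in atTop, B < signal M n := fun B hB =>
    eventually_lt_signal (fun B hB => hdist.eventually_moment_large hdiag hf hB) hB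
  let t : ℕ → ℕ := fun n => if PrefersEdge M n then 1 else 2
  have ht : ∀ n, t n = 1 ∨ t n = 2 := fun n => by
    by_cases h : PrefersEdge M n <;> simp [t, h]
  have hD : Distinguishes M (fun n => signedCount (starWithEdges (t n))) := by
    intro C _
    have hpos : 0 ≤ 12288 * C ^ 2 := by positivity
    have hpos' : 0 ≤ (256 * 6 ^ 6 * C ^ 2) ^ 2 := by positivity
    -- The sum of the constants serves both counts at once, since the choice may vary with `n`.
    filter_upwards [eventually_ge_atTop 4,
      hS (1 + 12288 * C ^ 2 + (256 * 6 ^ 6 * C ^ 2) ^ 2) (by linarith)] with n hn hsig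
    by_cases h : PrefersEdge M n
    · have htn : t n = 1 := if_pos h
      rw [signal, if_pos h] at hsig
      rw [htn]
      refine signedCount_gap one_ne_zero
        (starSum_one_gap (M n) (hdiag n) hn ?_ (by linarith) (by linarith))
      refine le_trans ?_ h
      refine le_mul_of_one_le_left ((M n).diagMoment_nonneg 3 even_two) (Real.one_le_sqrt.2 ?_)
      have : (0 : ℝ) ≤ firstIndex M n := Nat.cast_nonneg _
      linarith
    · have htn : t n = 2 := if_neg h
      rw [signal, if_neg h] at hsig
      rw [htn]
      exact signedCount_gap two_ne_zero
        (starSum_two_gap (M n) (hdiag n) hn (by linarith) (by linarith))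
  refine ⟨t, ht, fun m n h => ?_, hD, hD.exists_threshold fun n =>
    integral_signedCount_nullLaw ?_⟩
  · simp only [t, prefersEdge_congr h]
  · rcases ht n with h | h <;> simp [h]
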